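/- **Notation.** For $A=(a_{ij})\in\mathbb R^{p\times p}$ let $\|A\|_\infty=\max_{i,j}|a_{ij}|$ and $\|A\|_{L_1}=\max_j\sum_i|a_{ij}|$. For $0\le q<1$ let $\mathcal U_q(s,M)$ be the set of symmetric positive definite $W\in\mathbb R^{p\times p}$ with $\max_j\sum_i|w_{ij}|^q\le s$ (where $0^0=0$) and $\|W\|_{L_1}\le M$. **Model.** A random vector $\mathbf X\in\mathbb R^p$ is non-paranormal with latent correlation matrix $\Sigma$ ($\Sigma$ positive definite with unit diagonal) if $(f_1(X_1),\dots,f_p(X_p))\sim\mathcal N(0,\Sigma)$ for some Borel univariate functions $f_j$, each nondecreasing on a Borel set carrying $X_j$. Let $\Omega=\Sigma^{-1}$. **Estimators.** From data $(X_{kj})_{n\times p}$ let $r_{kj}$ be the rank of $X_{kj}$ in the $j$th column, let $\hat\rho_{ij}$ (Spearman's rho) be the Pearson correlation of the $i$th and $j$th columns of $(r_{kj})$, and let $\hat\tau_{ij}=\frac{2}{n(n-1)}\sum_{k<k'}\operatorname{sign}\{(X_{ki}-X_{k'i})(X_{kj}-X_{k'j})\}$ (Kendall's tau). Let $\tilde\Sigma_3$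 have unit diagonal and off-diagonal entries $2\sin(\frac\pi6\hat\rho_{ij})$ (Spearman version) or $\sin(\frac\pi2\hat\tau_{ij})$ (Kendall version). For $\varepsilon>0$ let $\hat\Sigma_3$ be any minimizer of $\|S-\tilde\Sigma_3\|_\infty$ over symmetric $S\succeq\varepsilon I$. For $\lambda\ge0$ let $\hat\beta_i$ minimize $\frac12\beta^{\mathsf T}\hat\Sigma_3\beta-e_i^{\mathsf T}\beta+\lambda|\beta|_1$ over $\beta\in\mathbb R^p$, let $\hat\Omega=(\hat\beta_1,\dots,\hat\beta_p)$, and let $\tilde\Omega_3$ be the symmetric matrix whose $(i,j)$ entry is the one of $\hat\Omega_{ij},\hat\Omega_{ji}$ that is smaller in absolute value (either one in case of a tie). **Theorem.** There is an absolute constant $c_0>0$ such that for all $C_0\ge c_0$ and $0\le q<1$ there are positive constants $C_1,C_2,K$, depending only on $C_0$ and $q$, with the following property. Consider any sequence of such problems, with sample size $n\to\infty$, dimension $p\ge2$, $n$ independent identically distributed non-paranormal observations with latent correlation matrix $\Sigma$, precision matrix $\Omega=\Sigma^{-1}\in\mathcal U_q(s_p,M_p)$, and projection level $\varepsilon>0$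 with $\Sigma\succeq\varepsilon I$ (where $p,\Sigma,s_p,M_p,\varepsilon$ may all vary along the sequence), and assume $$s_pM_p^{1-2q}=o\left(\Big(\frac n{\log p}\Big)^{\frac12-\frac q2}\right).$$ Let $\lambda=C_0M_p\sqrt{\log p/n}$. Then, for both the Spearman and the Kendall version and for all problems far enough along the sequence, with probability at least $1-K/p$ an estimator $\tilde\Omega_3$ exists and every such estimator (whatever minimizers and tie-breaks are chosen) satisfies $$\|\tilde\Omega_3-\Omega\|_\infty\le C_1M_p^2\sqrt{\frac{\log p}n},\qquad \|\tilde\Omega_3-\Omega\|_{L_1}\le C_2\,s_pM_p^{2-2q}\Big(\frac{\log p}n\Big)^{\frac12(1-q)}.$$ The probability bound is understood as: the complement of this event has outer measure at most $K/p$. -/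

import Mathlib

open MeasureTheory ProbabilityTheory Filter Asymptotics Matrix

noncomputable section

namespace SCIO

/-- The element-wise maximum norm `max_{i,j} |a_{ij}|`. -/
def maxNorm {p : ℕ} (A : Matrix (Fin p) (Fin p) ℝ) : ℝ :=
  ⨆ i, ⨆ j, |A i j|

/-- The matrix `ℓ₁` norm: the maximal absolute column sum `max_j ∑_i |a_{ij}|`. -/
def colNorm {p : ℕ} (A : Matrix (Fin p) (Fin p) ℝ) : ℝ :=
  ⨆ j, ∑ i, |A i j|

/-- `|x|^q` with the convention `0^0 = 0`, so that for `q = 0` it is the indicator of `x ≠ 0`. -/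
def absPow (q x : ℝ) : ℝ :=
  if x = 0 then 0 else |x| ^ q

/-- The class `𝒰_q(s, M)` of `s`-sparse positive definite matrices. -/
def sparseClass (p : ℕ) (q s M : ℝ) : Set (Matrix (Fin p) (Fin p) ℝ) :=
  {W | W.PosDef ∧ (∀ j, ∑ i, absPow q (W i j) ≤ s) ∧ colNorm W ≤ M}

/-- The law `ν` of a random vector `X` in `ℝ^p` is non-paranormal with latent correlation
matrix `S`: the matrix `S` is positive definite with unit diagonal, and there are nondecreasing
univariate functions `f_j` with `(f_1(X_1), …, f_p(X_p)) ∼ N(0, S)`. Each `f_j` only has to be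
nondecreasing on a Borel set `I_j` that carries `X_j` (such as `(0, ∞)` for a log-normal `X_j`). -/
def IsNonparanormal {p : ℕ} (ν : Measure (Fin p → ℝ)) (S : Matrix (Fin p) (Fin p) ℝ) : Prop :=
  S.PosDef ∧ (∀ j, S j j = 1) ∧
    ∃ (f : Fin p → ℝ → ℝ) (I : Fin p → Set ℝ),
      (∀ j, Measurable (f j)) ∧ (∀ j, MeasurableSet (I j)) ∧ (∀ j, MonotoneOn (f j) (I j)) ∧
      (∀ᵐ x ∂ν, ∀ j, x j ∈ I j) ∧
      ν.map (fun x => WithLp.toLp 2 (fun j => f j (x j))) = multivariateGaussian 0 S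

/-- The rows `X 1, …, X n` are independent random vectors with a common non-paranormal law with
latent correlation matrix `S`. -/
def IsNonparanormalSample {Ω : Type*} [MeasurableSpace Ω] (P : Measure Ω) {n p : ℕ}
    (X : Fin n → Ω → Fin p → ℝ) (S : Matrix (Fin p) (Fin p) ℝ) : Prop :=
  iIndepFun X P ∧ ∃ ν : Measure (Fin p → ℝ), IsNonparanormal ν S ∧ ∀ k, HasLaw (X k) ν P

/-- The rank of `x_{kj}` among `x_{1j}, …, x_{nj}` (smallest first). -/
def rank {n p : ℕ} (x : Fin n → Fin p → ℝ) (k : Fin n) (j : Fin p) : ℝ :=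
  ((Finset.univ.filter fun l => x l j ≤ x k j).card : ℝ)

/-- The mean of the ranks in column `j`. -/
def rankMean {n p : ℕ} (x : Fin n → Fin p → ℝ) (j : Fin p) : ℝ :=
  (∑ k, rank x k j) / n

/-- Spearman's rho between columns `i` and `j`: the Pearson correlation of the ranks. -/
def spearmanRho {n p : ℕ} (x : Fin n → Fin p → ℝ) (i j : Fin p) : ℝ :=
  (∑ k, (rank x k i - rankMean x i) * (rank x k j - rankMean x j)) /
    √((∑ k, (rank x k i - rankMean x i) ^ 2) * ∑ k, (rank x k j - rankMean x j) ^ 2)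

/-- Kendall's tau between columns `i` and `j`. -/
def kendallTau {n p : ℕ} (x : Fin n → Fin p → ℝ) (i j : Fin p) : ℝ :=
  2 / ((n : ℝ) * ((n : ℝ) - 1)) *
    ∑ k, ∑ l ∈ Finset.univ.filter (fun l => k < l),
      Real.sign ((x k i - x l i) * (x k j - x l j))

/-- The two rank statistics. -/
inductive RankStat
  | spearman
  | kendall

/-- The rank-based correlation estimator (before projection), from the data matrix `x`. -/
def pilot {n p : ℕ} (T : RankStat) (x : Fin n → Fin p → ℝ) : Matrix (Fin p) (Fin p) ℝ :=
  Matrix.of fun i j =>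
    if i = j then 1 else
      match T with
      | .spearman => 2 * Real.sin (Real.pi / 6 * spearmanRho x i j)
      | .kendall => Real.sin (Real.pi / 2 * kendallTau x i j)

/-- `S` minimizes `‖S - A‖_∞` among the symmetric matrices with `S ⪰ ε I`. The minimizer need not
be unique. -/
def IsProjection {p : ℕ} (ε : ℝ) (A S : Matrix (Fin p) (Fin p) ℝ) : Prop :=
  (S - ε • (1 : Matrix (Fin p) (Fin p) ℝ)).PosSemidef ∧
    ∀ S' : Matrix (Fin p) (Fin p) ℝ,
      (S' - ε • (1 : Matrix (Fin p) (Fin p) ℝ)).PosSemidef → maxNorm (S - A) ≤ maxNorm (S' - A)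

/-- The objective `½ βᵀ S β - e_iᵀ β + lam |β|₁`. -/
def loss {p : ℕ} (S : Matrix (Fin p) (Fin p) ℝ) (lam : ℝ) (i : Fin p) (β : Fin p → ℝ) : ℝ :=
  1 / 2 * (β ⬝ᵥ (S *ᵥ β)) - β i + lam * ∑ j, |β j|

/-- `W` is a SCIO estimator for the input `S` and the penalty `lam`: the `i`-th column of `B`
minimizes the `i`-th objective, and `W` is the symmetric matrix whose `(i, j)` entry is whichever
of `B i j`, `B j i` is smaller in absolute value (either one in case of a tie). -/
def IsSCIO {p : ℕ} (S : Matrix (Fin p) (Fin p) ℝ) (lam : ℝ)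
    (W : Matrix (Fin p) (Fin p) ℝ) : Prop :=
  ∃ B : Matrix (Fin p) (Fin p) ℝ,
    (∀ i β, loss S lam i (fun j => B j i) ≤ loss S lam i β) ∧
    W.IsSymm ∧
    ∀ i j, (W i j = B i j ∧ |B i j| ≤ |B j i|) ∨ (W i j = B j i ∧ |B j i| ≤ |B i j|)

/-- `W` is a SCIO estimator obtained from the projected rank-based correlation estimator. -/
def IsRankSCIO {n p : ℕ} (T : RankStat) (ε lam : ℝ) (x : Fin n → Fin p → ℝ)
    (W : Matrix (Fin p) (Fin p) ℝ) : Prop :=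
  ∃ S, IsProjection ε (pilot T x) S ∧ IsSCIO S lam W

end SCIO

end

/-! The argument splits into a deterministic part and a concentration part, joined by the event that
every entry of the pilot matrix is within `100 * δ` of the latent correlation, where `δ = √(log p /
n)`.

Deterministic part. The true matrix is feasible for the projection, so projecting at most doubles
the entrywise error (`IsProjection.abs_sub_le`). For a column `b` of the precision matrix and `h = β
- b`, optimality of `β` gives two facts: a stationarity bound on the gradient, and an `ℓ₁` cone
condition relative to the set of entries of `b` above a level `t`. Writing `h = S⁻¹ (S h)` bounds
`‖h‖_∞` by a multiple of `M * lam` plus `M * d * |h|₁`. The cone condition and weak sparsity turn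
`|h|₁` back into `‖h‖_∞` times a cardinality, and the rate assumption makes the resulting
coefficient small enough to absorb (`column_error`). With `t = M² δ` this yields both norms;
choosing the smaller entry costs only a constant because it never increases an entry of `B` in
absolute value (`IsSCIO.error_bounds`).

Concentration part. Without ties, both rank statistics are, up to a factor `1 + O(1/n)` (and a
factor 3 for Spearman), averages over all index triples of a product of two signs of differences.
Nondecreasing transformations preserve these signs almost surely, so the mean of the kernel is a
Gaussian orthant quantity, given by Sheppard's formula (`integral_sign_mul_sign_eq`): an arcsine of
`r` for Kendall and of `r / 2` for Spearman, which the sine in the pilot inverts. Changing one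
observation moves a triple average by at most `6 / n`, so McDiarmid's inequality and a union bound
over the `p²` entries finish the estimate (`IsNonparanormal.measure_pilot_le`). -/

namespace SCIO

/-! ### Entrywise and column-sum norms -/

section Norms

variable {p : ℕ} {A : Matrix (Fin p) (Fin p) ℝ}

lemma abs_le_maxNorm (A : Matrix (Fin p) (Fin p) ℝ) (i j : Fin p) : |A i j| ≤ maxNorm A :=
  (le_ciSup (Set.finite_range fun j => |A i j|).bddAbove j).trans
    (le_ciSup (Set.finite_range fun i => ⨆ j, |A i j|).bddAbove i)

lemma maxNorm_le {c : ℝ} (hc : 0 ≤ c) (h : ∀ i j, |A i j| ≤ c) : maxNorm A ≤ c :=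
  Real.iSup_le (fun i => Real.iSup_le (h i) hc) hc

lemma maxNorm_nonneg (A : Matrix (Fin p) (Fin p) ℝ) : 0 ≤ maxNorm A :=
  Real.iSup_nonneg fun _ => Real.iSup_nonneg fun _ => abs_nonneg _

lemma sum_le_colNorm (A : Matrix (Fin p) (Fin p) ℝ) (j : Fin p) : ∑ i, |A i j| ≤ colNorm A :=
  le_ciSup (Set.finite_range fun j => ∑ i, |A i j|).bddAbove j

lemma colNorm_le {c : ℝ} (hc : 0 ≤ c) (h : ∀ j, ∑ i, |A i j| ≤ c) : colNorm A ≤ c :=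
  Real.iSup_le h hc

end Norms

/-! ### Projection in the maximum norm -/

section Projection

variable {p : ℕ} {ε : ℝ} {A S Ŝ : Matrix (Fin p) (Fin p) ℝ}

/-- The projection at most doubles the entrywise error with respect to a feasible matrix. -/
lemma IsProjection.abs_sub_le {d : ℝ} (h : IsProjection ε A Ŝ)
    (hS : (S - ε • (1 : Matrix (Fin p) (Fin p) ℝ)).PosSemidef) (hd : 0 ≤ d)
    (hA : ∀ i j, |A i j - S i j| ≤ d) (i j : Fin p) : |Ŝ i j - S i j| ≤ 2 * d := by
  have h1 : maxNorm (S - A) ≤ d :=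
    maxNorm_le hd fun i j => by rw [Matrix.sub_apply, abs_sub_comm]; exact hA i j
  have h2 := (abs_le_maxNorm (Ŝ - A) i j).trans ((h.2 S hS).trans h1)
  rw [Matrix.sub_apply] at h2
  calc |Ŝ i j - S i j| = |(Ŝ i j - A i j) + (A i j - S i j)| := by ring_nf
    _ ≤ _ := abs_add_le _ _
    _ ≤ 2 * d := by linarith [hA i j]

/-- Symmetry and each quadratic-form inequality are closed conditions on the entries. Closedness is
what makes a nearest point exist. -/
lemma isClosed_setOf_posSemidef_sub (ε : ℝ) :
    IsClosed {f : Fin p → Fin p → ℝ |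
      (Matrix.of f - ε • (1 : Matrix (Fin p) (Fin p) ℝ)).PosSemidef} := by
  simp_rw [Matrix.posSemidef_iff_dotProduct_mulVec, Set.ofPred_and, Set.ofPred_forall]
  refine IsClosed.inter ?_ (isClosed_iInter fun x => ?_)
  · simp_rw [Matrix.IsHermitian.ext_iff, Set.ofPred_forall]
    refine isClosed_iInter fun i => isClosed_iInter fun j => isClosed_eq ?_ ?_
    · simp only [Matrix.sub_apply, Matrix.of_apply, star_trivial]; fun_prop
    · simp only [Matrix.sub_apply, Matrix.of_apply]; fun_prop
  · refine isClosed_le continuous_const ?_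
    simp only [dotProduct, mulVec, Matrix.sub_apply, Matrix.of_apply]
    fun_prop

/-- The product distance on `Fin p → Fin p → ℝ` is the maximum norm of the difference, and a
nonempty closed set in this proper space contains a nearest point. -/
lemma exists_isProjection (A : Matrix (Fin p) (Fin p) ℝ)
    (hS : (S - ε • (1 : Matrix (Fin p) (Fin p) ℝ)).PosSemidef) : ∃ Ŝ, IsProjection ε A Ŝ := by
  obtain ⟨f, hf, hdist⟩ := (isClosed_setOf_posSemidef_sub (p := p) ε).exists_infDist_eq_dist
    ⟨fun i j => S i j, hS⟩ (fun i j => A i j)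
  refine ⟨Matrix.of f, hf, fun S' hS' => ?_⟩
  have h1 : dist (fun i j => A i j) f ≤ dist (fun i j => A i j) (fun i j => S' i j) :=
    hdist ▸ Metric.infDist_le_dist_of_mem (by exact hS')
  have h2 : dist (fun i j => A i j) (fun i j => S' i j) ≤ maxNorm (S' - A) := by
    refine (dist_pi_le_iff (maxNorm_nonneg _)).2 fun i =>
      (dist_pi_le_iff (maxNorm_nonneg _)).2 fun j => ?_
    rw [Real.dist_eq, abs_sub_comm]
    exact abs_le_maxNorm (S' - A) i j
  refine (maxNorm_le dist_nonneg fun i j => ?_).trans (h1.trans h2)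
  rw [Matrix.sub_apply, Matrix.of_apply, abs_sub_comm, ← Real.dist_eq]
  exact (dist_le_pi_dist (fun j => A i j) (f i) j).trans
    (dist_le_pi_dist (fun i j => A i j) f i)

lemma isSymm_of_posSemidef_sub
    (h : (S - ε • (1 : Matrix (Fin p) (Fin p) ℝ)).PosSemidef) : S.IsSymm := by
  ext i j
  have := h.1.apply i j
  by_cases hij : i = j
  · subst hij; rfl
  · simpa [Matrix.one_apply, hij, Ne.symm hij] using this

lemma quadForm_ge_of_posSemidef_sub
    (h : (S - ε • (1 : Matrix (Fin p) (Fin p) ℝ)).PosSemidef) (β : Fin p → ℝ) :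
    ε * ∑ j, β j ^ 2 ≤ β ⬝ᵥ (S *ᵥ β) := by
  have := h.dotProduct_mulVec_nonneg β
  rw [Matrix.sub_mulVec, Matrix.smul_mulVec, Matrix.one_mulVec, dotProduct_sub,
    dotProduct_smul] at this
  simp only [star_trivial, smul_eq_mul] at this
  have h2 : β ⬝ᵥ β = ∑ j, β j ^ 2 := by simp [dotProduct, sq]
  rw [h2] at this
  linarith

end Projection

/-! ### The penalized column problem: existence, stationarity, cone condition -/

section Loss

variable {p : ℕ} {S : Matrix (Fin p) (Fin p) ℝ} {lam : ℝ} {i : Fin p}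

/-- The objective is continuous and coercive: it dominates `‖β‖ * (ε / 2 * ‖β‖ - 1)`. -/
lemma exists_forall_loss_le {ε : ℝ} (hε : 0 < ε)
    (hS : (S - ε • (1 : Matrix (Fin p) (Fin p) ℝ)).PosSemidef) (hlam : 0 ≤ lam) (i : Fin p) :
    ∃ β, ∀ β', loss S lam i β ≤ loss S lam i β' := by
  refine Continuous.exists_forall_le ?_ ?_
  · unfold loss
    simp only [dotProduct, mulVec]
    fun_prop
  · have h1 : Tendsto (fun x : ℝ => x * (ε / 2 * x - 1)) atTop atTop :=
      tendsto_id.atTop_mul_atTop₀ (tendsto_atTop_add_const_right _ (-1)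
        (tendsto_id.const_mul_atTop (half_pos hε)))
    refine tendsto_atTop_mono (fun β => ?_)
      (h1.comp (tendsto_norm_cocompact_atTop (E := Fin p → ℝ)))
    have h2 := quadForm_ge_of_posSemidef_sub hS β
    have h3 : |β i| ≤ ‖β‖ := norm_le_pi_norm β i
    have h4 : 0 ≤ lam * ∑ j, |β j| := mul_nonneg hlam (Finset.sum_nonneg fun _ _ => abs_nonneg _)
    have h5 : ‖β‖ ^ 2 ≤ ∑ j, β j ^ 2 := by
      obtain ⟨k, -, hk⟩ := Finset.exists_max_image Finset.univ (fun j => |β j|) ⟨i, by simp⟩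
      have h6 : ‖β‖ ≤ |β k| := (pi_norm_le_iff_of_nonneg (abs_nonneg _)).2 fun j => hk j (by simp)
      calc ‖β‖ ^ 2 ≤ |β k| ^ 2 := by gcongr
        _ = β k ^ 2 := sq_abs _
        _ ≤ _ := Finset.single_le_sum (f := fun j => β j ^ 2) (fun _ _ => sq_nonneg _)
          (Finset.mem_univ k)
    have h7 := mul_le_mul_of_nonneg_left h5 hε.le
    have h8 := le_abs_self (β i)
    simp only [Function.comp_apply, loss]
    nlinarith

/-- The smooth part is quadratic, so its second-order expansion is exact; symmetry merges the two
cross terms. Stationarity and the cone condition both start here. -/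
lemma loss_add (hS : S.IsSymm) (lam : ℝ) (i : Fin p) (β h : Fin p → ℝ) :
    loss S lam i (β + h) = loss S lam i β + (h ⬝ᵥ (S *ᵥ β) - h i) + 1 / 2 * (h ⬝ᵥ (S *ᵥ h)) +
      lam * (∑ j, |β j + h j| - ∑ j, |β j|) := by
  have h1 : β ⬝ᵥ (S *ᵥ h) = h ⬝ᵥ (S *ᵥ β) := by
    rw [dotProduct_mulVec, ← mulVec_transpose, hS, dotProduct_comm]
  simp only [loss, mulVec_add, dotProduct_add, add_dotProduct, h1, Pi.add_apply]
  ring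

/-- The stationarity condition of the `i`-th column problem. -/
lemma abs_mulVec_sub_le_of_forall_loss_le (hlam : 0 ≤ lam) (hS : S.IsSymm) {β : Fin p → ℝ}
    (hβ : ∀ β', loss S lam i β ≤ loss S lam i β') (j : Fin p) :
    |(S *ᵥ β) j - (if j = i then 1 else 0)| ≤ lam := by
  set g := (S *ᵥ β) j - (if j = i then 1 else 0) with hg
  have key : ∀ t : ℝ, 0 ≤ t * g + t ^ 2 * (S j j / 2) + lam * (|β j + t| - |β j|) := by
    intro t
    have h1 := hβ (β + Pi.single j t)
    rw [loss_add hS] at h1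
    have h2 : ∑ k, |β k + (Pi.single j t : Fin p → ℝ) k| - ∑ k, |β k| = |β j + t| - |β j| := by
      rw [← Finset.sum_sub_distrib, Finset.sum_eq_single j]
      · simp
      · intro b _ hb; simp [hb]
      · simp
    have h3 : (Pi.single j t : Fin p → ℝ) i = t * (if j = i then 1 else 0) := by
      by_cases hji : j = i
      · subst hji; simp
      · simp [hji, Ne.symm hji]
    have h4 : S *ᵥ (Pi.single j t : Fin p → ℝ) = fun k => S k j * t := by
      ext k; simp [mulVec, dotProduct, Pi.single_apply]
    rw [h2, single_dotProduct, h3, h4, single_dotProduct] at h1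
    rw [hg]
    linarith
  by_contra hlt
  push Not at hlt
  have hc : 0 ≤ |S j j / 2| := abs_nonneg _
  -- A step of length `r` against the gradient changes the loss by at most `r * (r * |S j j / 2| +
  -- lam - |g|)`, and this choice of `r` makes that equal to `-r ^ 2`.
  obtain ⟨r, hr, hrc⟩ : ∃ r : ℝ, 0 < r ∧ r * (|S j j / 2| + 1) = |g| - lam :=
    ⟨(|g| - lam) / (|S j j / 2| + 1), div_pos (sub_pos.2 hlt) (by linarith),
      div_mul_cancel₀ _ (by linarith)⟩
  have hstep : ∀ t : ℝ, |t| = r → t * g = -(r * |g|) → False := by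
    intro t ht htg
    have h1 := key t
    have h2 : |β j + t| - |β j| ≤ r := by linarith [abs_add_le (β j) t]
    have h3 := mul_le_mul_of_nonneg_left h2 hlam
    have h4 : t ^ 2 = r ^ 2 := by rw [← sq_abs, ht]
    have h5 : r ^ 2 * (S j j / 2) ≤ r ^ 2 * |S j j / 2| :=
      mul_le_mul_of_nonneg_left (le_abs_self _) (sq_nonneg _)
    rw [htg, h4] at h1
    have h6 : 0 ≤ r * (r * |S j j / 2| + lam - |g|) := by nlinarith
    have h7 := nonneg_of_mul_nonneg_right h6 hr
    nlinarith
  rcases le_total 0 g with hg0 | hg0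
  · exact hstep (-r) (by rw [abs_neg, abs_of_pos hr]) (by rw [abs_of_nonneg hg0]; ring)
  · exact hstep r (abs_of_pos hr) (by rw [abs_of_nonpos hg0]; ring)

/-- The `ℓ₁` cone condition of a penalized minimizer, relative to any set `T` of coordinates. -/
lemma sum_compl_abs_sub_le (hS : S.PosSemidef) (hsymm : S.IsSymm) (hlam : 0 < lam)
    {β b : Fin p → ℝ} (hβ : loss S lam i β ≤ loss S lam i b)
    (hb : ∀ j, |(S *ᵥ b) j - (if j = i then 1 else 0)| ≤ lam / 2) (T : Finset (Fin p)) :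
    ∑ j ∈ Tᶜ, |β j - b j| ≤ 3 * ∑ j ∈ T, |β j - b j| + 4 * ∑ j ∈ Tᶜ, |b j| := by
  set h : Fin p → ℝ := β - b with hh
  have h0 : β = b + h := by rw [hh]; abel
  rw [h0, loss_add hsymm] at hβ
  have h1 : 0 ≤ h ⬝ᵥ (S *ᵥ h) := by simpa using hS.dotProduct_mulVec_nonneg h
  have h2 : -(lam / 2 * ∑ j, |h j|) ≤ h ⬝ᵥ (S *ᵥ b) - h i := by
    have h3 : h ⬝ᵥ (S *ᵥ b) - h i = ∑ j, h j * ((S *ᵥ b) j - (if j = i then 1 else 0)) := by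
      simp [dotProduct, mul_sub, Finset.sum_sub_distrib]
    rw [h3, Finset.mul_sum, ← Finset.sum_neg_distrib]
    refine Finset.sum_le_sum fun j _ => ?_
    have h4 := abs_mul (h j) ((S *ᵥ b) j - (if j = i then 1 else 0))
    have h5 := mul_le_mul_of_nonneg_left (hb j) (abs_nonneg (h j))
    have h6 := neg_abs_le (h j * ((S *ᵥ b) j - (if j = i then 1 else 0)))
    linarith
  -- Drop the nonnegative quadratic term, bound the linear one by `h2`, and divide by `lam`.
  have h7 : ∑ j, |b j + h j| - ∑ j, |b j| ≤ 1 / 2 * ∑ j, |h j| := by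
    have : lam * (∑ j, |b j + h j| - ∑ j, |b j|) ≤ lam * (1 / 2 * ∑ j, |h j|) := by linarith
    exact le_of_mul_le_mul_left this hlam
  have h8 : ∑ j ∈ T, |b j| - ∑ j ∈ T, |h j| ≤ ∑ j ∈ T, |b j + h j| := by
    rw [← Finset.sum_sub_distrib]
    refine Finset.sum_le_sum fun j _ => ?_
    have := abs_sub_abs_le_abs_sub (b j) (-h j)
    rw [abs_neg, sub_neg_eq_add] at this
    exact this
  have h9 : ∑ j ∈ Tᶜ, |h j| - ∑ j ∈ Tᶜ, |b j| ≤ ∑ j ∈ Tᶜ, |b j + h j| := by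
    rw [← Finset.sum_sub_distrib]
    refine Finset.sum_le_sum fun j _ => ?_
    have := abs_sub_abs_le_abs_sub (h j) (-b j)
    rw [abs_neg, sub_neg_eq_add, add_comm] at this
    exact this
  rw [← Finset.sum_add_sum_compl T, ← Finset.sum_add_sum_compl T (fun j => |b j|),
    ← Finset.sum_add_sum_compl T (fun j => |h j|)] at h7
  have h10 : ∀ j, β j - b j = h j := fun j => rfl
  simp only [h10]
  linarith

end Loss

/-! ### Consequences of weak sparsity -/

section Sparsity

variable {p : ℕ} {q s t : ℝ} {b : Fin p → ℝ}

lemma absPow_nonneg (q x : ℝ) : 0 ≤ absPow q x := by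
  unfold absPow
  split_ifs
  · exact le_rfl
  · positivity

/-- The number of coordinates above the level `t` of a weakly sparse vector. -/
lemma card_filter_lt_abs_mul_rpow_le (hq : 0 ≤ q) (ht : 0 < t) (hb : ∑ i, absPow q (b i) ≤ s) :
    ((Finset.univ.filter fun j => t < |b j|).card : ℝ) * t ^ q ≤ s := by
  rw [← nsmul_eq_mul, ← Finset.sum_const]
  refine le_trans (Finset.sum_le_sum fun j hj => ?_) ((Finset.sum_le_univ_sum_of_nonneg
    fun j => absPow_nonneg q (b j)).trans hb)
  have hj : t < |b j| := (Finset.mem_filter.1 hj).2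
  rw [absPow, if_neg (abs_pos.1 (ht.trans hj))]
  gcongr

/-- The `ℓ₁` mass below the level `t` of a weakly sparse vector. -/
lemma sum_compl_filter_lt_abs_le (hq1 : q < 1) (ht : 0 < t)
    (hb : ∑ i, absPow q (b i) ≤ s) :
    ∑ j ∈ (Finset.univ.filter fun j => t < |b j|)ᶜ, |b j| ≤ s * t ^ (1 - q) := by
  refine le_trans (Finset.sum_le_sum (g := fun j => absPow q (b j) * t ^ (1 - q))
    fun j hj => ?_) ?_
  · have hj : |b j| ≤ t := by simpa using hj
    by_cases h0 : b j = 0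
    · simp [h0, absPow]
    · have h1 : 0 < |b j| := abs_pos.2 h0
      rw [absPow, if_neg h0]
      calc |b j| = |b j| ^ q * |b j| ^ (1 - q) := by
            rw [← Real.rpow_add h1, add_sub_cancel, Real.rpow_one]
        _ ≤ _ := by
            gcongr
  · rw [← Finset.sum_mul]
    gcongr
    exact (Finset.sum_le_univ_sum_of_nonneg fun j => absPow_nonneg q (b j)).trans hb

end Sparsity

/-! ### Deterministic error bounds and existence of the estimator -/

section Bounds

variable {p : ℕ} {q s M lam d t C : ℝ} {S Ŝ W : Matrix (Fin p) (Fin p) ℝ}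

lemma abs_mulVec_le {A : Matrix (Fin p) (Fin p) ℝ} (hA : ∀ i j, |A i j| ≤ d) (v : Fin p → ℝ)
    (k : Fin p) : |(A *ᵥ v) k| ≤ d * ∑ j, |v j| := by
  rw [mulVec, dotProduct, Finset.mul_sum]
  refine (Finset.abs_sum_le_sum_abs _ _).trans (Finset.sum_le_sum fun j _ => ?_)
  rw [abs_mul]
  exact mul_le_mul_of_nonneg_right (hA k j) (abs_nonneg _)

/-- The error of one column of the estimator, in the maximum norm and off the large entries. -/
lemma column_error (hS : S.PosDef) (hΩ : S⁻¹ ∈ sparseClass p q s M) (hq : 0 ≤ q) (hq1 : q < 1)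
    (hŜ : Ŝ.PosSemidef) (hsymm : Ŝ.IsSymm) (hd : 0 ≤ d) (hŜS : ∀ i j, |Ŝ i j - S i j| ≤ d)
    (hlam : 0 < lam) (hdM : d * M ≤ lam / 2) (ht : 0 < t) (hMlam : M * lam ≤ C * t)
    (hsmall : 8 * (M * d * s) ≤ t ^ q) (i : Fin p) {β : Fin p → ℝ}
    (hβ : ∀ β', loss Ŝ lam i β ≤ loss Ŝ lam i β') :
    (∀ j, |β j - S⁻¹ j i| ≤ (3 * C + 1) * t) ∧
    ∑ j ∈ (Finset.univ.filter fun j => t < |S⁻¹ j i|)ᶜ, |β j - S⁻¹ j i| ≤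
      3 * ∑ j ∈ (Finset.univ.filter fun j => t < |S⁻¹ j i|), |β j - S⁻¹ j i| +
        4 * ∑ j ∈ (Finset.univ.filter fun j => t < |S⁻¹ j i|)ᶜ, |S⁻¹ j i| := by
  obtain ⟨hΩpd, hΩs, hΩM⟩ := hΩ
  set b : Fin p → ℝ := fun j => S⁻¹ j i with hb
  set T := Finset.univ.filter fun j => t < |b j| with hT
  have hbM : ∑ j, |b j| ≤ M := (sum_le_colNorm S⁻¹ i).trans hΩM
  have hM : 0 ≤ M := (Finset.sum_nonneg fun _ _ => abs_nonneg _).trans hbM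
  have hdet : IsUnit S.det := (Matrix.isUnit_iff_isUnit_det S).1 hS.isUnit
  have hSb : ∀ j, (S *ᵥ b) j = if j = i then 1 else 0 := fun j => by
    have := congrFun (congrFun (Matrix.mul_nonsing_inv S hdet) j) i
    rwa [Matrix.mul_apply, Matrix.one_apply] at this
  have hdiff : ∀ v k, |((Ŝ - S) *ᵥ v) k| ≤ d * ∑ j, |v j| := fun v k => abs_mulVec_le hŜS v k
  have hŜb : ∀ j, |(Ŝ *ᵥ b) j - (if j = i then 1 else 0)| ≤ lam / 2 := fun j => by
    rw [← hSb, ← Pi.sub_apply, ← Matrix.sub_mulVec]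
    exact (hdiff b j).trans ((mul_le_mul_of_nonneg_left hbM hd).trans hdM)
  have hcone := sum_compl_abs_sub_le hŜ hsymm hlam (hβ b) hŜb T
  refine ⟨?_, hcone⟩
  set h : Fin p → ℝ := β - b with hh
  have hhj : ∀ j, β j - b j = h j := fun j => rfl
  simp only [hhj] at hcone
  have hkkt := abs_mulVec_sub_le_of_forall_loss_le hlam.le hsymm hβ
  -- The cone condition leaves four times the mass on `T`, at most `‖h‖` per entry, plus four times
  -- the tail of `b`.
  have hl1 : ∑ j, |h j| ≤ 4 * (T.card * ‖h‖) + 4 * (s * t ^ (1 - q)) := by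
    have h1 := sum_compl_filter_lt_abs_le hq1 ht (hΩs i)
    have h2 : ∑ j ∈ T, |h j| ≤ T.card * ‖h‖ := by
      rw [← nsmul_eq_mul, ← Finset.sum_const]
      exact Finset.sum_le_sum fun j _ => norm_le_pi_norm h j
    rw [← Finset.sum_add_sum_compl T]
    have h3 : ∑ j ∈ Tᶜ, |b j| ≤ s * t ^ (1 - q) := h1
    linarith
  -- Stationarity of `β` contributes `lam`, approximate stationarity of `b` contributes `lam / 2`,
  -- and replacing `Ŝ` by `S` costs the last term.
  have hSh : ∀ k, |(S *ᵥ h) k| ≤ 3 / 2 * lam + d * ∑ j, |h j| := fun k => by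
    have h1 : (S *ᵥ h) k = ((Ŝ *ᵥ β) k - (if k = i then 1 else 0)) -
        ((Ŝ *ᵥ b) k - (if k = i then 1 else 0)) - ((Ŝ - S) *ᵥ h) k := by
      rw [Matrix.sub_mulVec, hh, Matrix.mulVec_sub, Matrix.mulVec_sub]
      simp only [Pi.sub_apply]
      ring
    rw [h1]
    have h2 := abs_sub (((Ŝ *ᵥ β) k - (if k = i then 1 else 0)) -
        ((Ŝ *ᵥ b) k - (if k = i then 1 else 0))) (((Ŝ - S) *ᵥ h) k)
    have h3 := abs_sub ((Ŝ *ᵥ β) k - (if k = i then 1 else 0))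
        ((Ŝ *ᵥ b) k - (if k = i then 1 else 0))
    linarith [hkkt k, hŜb k, hdiff h k]
  have hR : 0 ≤ 3 / 2 * lam + d * ∑ j, |h j| := by positivity
  have hnorm : ‖h‖ ≤ M * (3 / 2 * lam + d * ∑ j, |h j|) := by
    refine (pi_norm_le_iff_of_nonneg (mul_nonneg hM hR)).2 fun j => ?_
    have h1 : h j = ∑ k, S⁻¹ j k * (S *ᵥ h) k := by
      change h j = (S⁻¹ *ᵥ (S *ᵥ h)) j
      rw [Matrix.mulVec_mulVec, Matrix.nonsing_inv_mul S hdet, Matrix.one_mulVec]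
    rw [h1, Real.norm_eq_abs]
    calc |∑ k, S⁻¹ j k * (S *ᵥ h) k| ≤ ∑ k, |S⁻¹ j k * (S *ᵥ h) k| := Finset.abs_sum_le_sum_abs _ _
      _ ≤ ∑ k, |S⁻¹ k j| * (3 / 2 * lam + d * ∑ j, |h j|) := Finset.sum_le_sum fun k _ => by
          have h2 : S⁻¹ j k = S⁻¹ k j := by simpa using (hΩpd.1.apply j k).symm
          rw [abs_mul, h2]
          exact mul_le_mul_of_nonneg_left (hSh k) (abs_nonneg _)
      _ ≤ _ := by
          rw [← Finset.sum_mul]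
          exact mul_le_mul_of_nonneg_right ((sum_le_colNorm S⁻¹ j).trans hΩM) hR
  have htq : 0 < t ^ q := Real.rpow_pos_of_pos ht q
  have hcard := card_filter_lt_abs_mul_rpow_le hq ht (hΩs i)
  have hMd : 0 ≤ M * d := mul_nonneg hM hd
  have hcN : 8 * (M * d * T.card) ≤ 1 := by
    have h1 : 8 * (M * d * T.card) * t ^ q ≤ 1 * t ^ q := by
      have := mul_le_mul_of_nonneg_left hcard hMd
      have h2 : M * d * (T.card * t ^ q) ≤ M * d * s := this
      linarith
    exact le_of_mul_le_mul_right h1 htq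
  have hst : 8 * (M * d * (s * t ^ (1 - q))) ≤ t := by
    have h1 : t ^ q * t ^ (1 - q) = t := by
      rw [← Real.rpow_add ht, add_sub_cancel, Real.rpow_one]
    have h2 := mul_le_mul_of_nonneg_right hsmall (Real.rpow_nonneg ht.le (1 - q))
    rw [h1] at h2
    linarith
  -- By `hcN` and `hst` the `ℓ₁` term is at most `‖h‖ / 2 + t / 2`. Half of `‖h‖` is absorbed on the
  -- left, and `3 / 2 * M * lam ≤ 3 / 2 * C * t` is doubled.
  have hN : ‖h‖ ≤ (3 * C + 1) * t := by
    have h1 := mul_le_mul_of_nonneg_left hl1 hMd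
    have h2 := mul_le_mul_of_nonneg_right hcN (norm_nonneg h)
    nlinarith
  exact fun j => (norm_le_pi_norm h j).trans hN

/-- The deterministic error bounds of the SCIO estimator. -/
lemma IsSCIO.error_bounds (hS : S.PosDef) (hΩ : S⁻¹ ∈ sparseClass p q s M) (hq : 0 ≤ q)
    (hq1 : q < 1) (hŜ : Ŝ.PosSemidef) (hsymm : Ŝ.IsSymm) (hd : 0 ≤ d)
    (hŜS : ∀ i j, |Ŝ i j - S i j| ≤ d) (hlam : 0 < lam) (hdM : d * M ≤ lam / 2) (ht : 0 < t)
    (hC : 0 ≤ C) (hMlam : M * lam ≤ C * t) (hsmall : 8 * (M * d * s) ≤ t ^ q) (hs : 0 ≤ s)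
    (hW : IsSCIO Ŝ lam W) :
    maxNorm (W - S⁻¹) ≤ (3 * C + 1) * t ∧
      colNorm (W - S⁻¹) ≤ (12 * C + 10) * (s * t ^ (1 - q)) := by
  obtain ⟨B, hB, hWsymm, hWB⟩ := hW
  have hcol := fun i => column_error hS hΩ hq hq1 hŜ hsymm hd hŜS hlam hdM ht hMlam hsmall i (hB i)
  have hΩsymm : ∀ i j, S⁻¹ j i = S⁻¹ i j := fun i j => by simpa using hΩ.1.1.apply i j
  have hbound : 0 ≤ (3 * C + 1) * t := by positivity
  have hmax : ∀ i j, |W i j - S⁻¹ i j| ≤ (3 * C + 1) * t := fun i j => by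
    rcases hWB i j with ⟨h, -⟩ | ⟨h, -⟩
    · rw [h]; exact (hcol j).1 i
    · rw [h, ← hΩsymm]; exact (hcol i).1 j
  have habs : ∀ i j, |W i j| ≤ |B i j| := fun i j => by
    rcases hWB i j with ⟨h, h'⟩ | ⟨h, h'⟩
    · rw [h]
    · rw [h]; exact h'
  have ht1 : 0 ≤ t ^ (1 - q) := Real.rpow_nonneg ht.le _
  refine ⟨maxNorm_le hbound hmax, colNorm_le (by positivity) fun j => ?_⟩
  simp only [Matrix.sub_apply]
  set T := Finset.univ.filter fun i => t < |S⁻¹ i j| with hT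
  have hcone := (hcol j).2
  rw [← hT] at hcone
  have hlow : ∑ i ∈ Tᶜ, |S⁻¹ i j| ≤ s * t ^ (1 - q) :=
    sum_compl_filter_lt_abs_le hq1 ht (hΩ.2.1 j)
  have hcard : (T.card : ℝ) * t ≤ s * t ^ (1 - q) := by
    have h1 : t ^ q * t ^ (1 - q) = t := by
      rw [← Real.rpow_add ht, add_sub_cancel, Real.rpow_one]
    have h2 := mul_le_mul_of_nonneg_right (card_filter_lt_abs_mul_rpow_le hq ht (hΩ.2.1 j)) ht1
    rwa [mul_assoc, h1] at h2
  have hsumT : ∀ f : Fin p → ℝ, (∀ i, |f i| ≤ (3 * C + 1) * t) →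
      ∑ i ∈ T, |f i| ≤ (3 * C + 1) * (s * t ^ (1 - q)) := fun f hf => by
    calc ∑ i ∈ T, |f i| ≤ T.card • ((3 * C + 1) * t) := Finset.sum_le_card_nsmul _ _ _ fun i _ => hf i
      _ = (3 * C + 1) * (T.card * t) := by rw [nsmul_eq_mul]; ring
      _ ≤ _ := by gcongr
  have h1 := hsumT (fun i => W i j - S⁻¹ i j) fun i => hmax i j
  have h2 := hsumT (fun i => B i j - S⁻¹ i j) (hcol j).1
  -- The cone condition is known for `B`, not for `W`. Since `|W i j| ≤ |B i j|`, passing from one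
  -- to the other costs only twice the tail of the true column.
  have h3 : ∑ i ∈ Tᶜ, |W i j - S⁻¹ i j| ≤
      ∑ i ∈ Tᶜ, |B i j - S⁻¹ i j| + 2 * ∑ i ∈ Tᶜ, |S⁻¹ i j| := by
    rw [Finset.mul_sum, ← Finset.sum_add_distrib]
    refine Finset.sum_le_sum fun i _ => ?_
    have h4 := abs_sub (W i j) (S⁻¹ i j)
    have h5 := abs_sub_abs_le_abs_sub (B i j) (S⁻¹ i j)
    linarith [habs i j]
  -- In units of `s * t ^ (1 - q)`: `3C + 1` on `T`, and `3(3C + 1) + 4 + 2` off `T`.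
  rw [← Finset.sum_add_sum_compl T]
  linarith

lemma exists_isSCIO {ε : ℝ} (hε : 0 < ε)
    (hS : (S - ε • (1 : Matrix (Fin p) (Fin p) ℝ)).PosSemidef) (hlam : 0 ≤ lam) :
    ∃ W, IsSCIO S lam W := by
  choose β hβ using exists_forall_loss_le hε hS hlam
  set B : Matrix (Fin p) (Fin p) ℝ := Matrix.of fun j i => β i j with hB
  -- Equal absolute values may carry opposite signs, so ties are broken by the unordered pair of
  -- indices to keep the matrix symmetric.
  refine ⟨Matrix.of fun i j => if |B i j| < |B j i| then B i j else if |B j i| < |B i j| then B j i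
    else B (min i j) (max i j), B, fun i => hβ i, ?_, fun i j => ?_⟩
  · ext i j
    simp only [Matrix.transpose_apply, Matrix.of_apply]
    rcases lt_trichotomy |B i j| |B j i| with h | h | h
    · simp [h, h.le]
    · simp [h, min_comm, max_comm]
    · simp [h, h.le]
  · simp only [Matrix.of_apply]
    rcases lt_trichotomy |B i j| |B j i| with h | h | h
    · simp [h, h.le]
    · simp only [h, lt_irrefl, if_false, le_refl, and_true]
      rcases le_total i j with hij | hij
      · simp [hij]
      · simp [hij]
    · simp [h, h.le, h.not_gt]

lemma exists_isRankSCIO {n : ℕ} (T : RankStat) {ε : ℝ} (hε : 0 < ε)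
    (hS : (S - ε • (1 : Matrix (Fin p) (Fin p) ℝ)).PosSemidef) (hlam : 0 ≤ lam)
    (x : Fin n → Fin p → ℝ) : ∃ W, IsRankSCIO T ε lam x W := by
  obtain ⟨Ŝ, hŜ⟩ := exists_isProjection (pilot T x) hS
  obtain ⟨W, hW⟩ := exists_isSCIO hε hŜ.1 hlam
  exact ⟨W, Ŝ, hŜ, hW⟩

end Bounds

/-! ### McDiarmid's inequality -/

section BoundedDifferences

/-- A function that changes by at most `c` when one coordinate changes is bounded. -/
lemma abs_sub_le_of_bounded_differences {α : Type*} {n : ℕ} {f : (Fin n → α) → ℝ} {c : ℝ}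
    (hf : ∀ x i a, |f (Function.update x i a) - f x| ≤ c) (x y : Fin n → α) :
    |f x - f y| ≤ n * c := by
  -- Pass from `y` to `x` one coordinate at a time.
  have key : ∀ T : Finset (Fin n), |f (T.piecewise x y) - f y| ≤ T.card * c := by
    intro T
    induction T using Finset.induction_on with
    | empty => simp
    | insert i T hi ih =>
      rw [Finset.piecewise_insert, Finset.card_insert_of_notMem hi]
      have h1 := hf (T.piecewise x y) i (x i)
      have h2 := abs_sub_le (f (Function.update (T.piecewise x y) i (x i)))
        (f (T.piecewise x y)) (f y)
      push_cast
      linarith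
  simpa using key Finset.univ

variable {α : Type*} [MeasurableSpace α] (ν : Measure α) [IsProbabilityMeasure ν]

lemma integral_pi_succ {n : ℕ} {φ : (Fin (n + 1) → α) → ℝ}
    (hφ : Integrable φ (Measure.pi fun _ => ν)) :
    ∫ x, φ x ∂(Measure.pi fun _ => ν) =
      ∫ y, ∫ a, φ (Fin.cons a y) ∂ν ∂(Measure.pi fun _ : Fin n => ν) := by
  have h := (measurePreserving_piFinSuccAbove (fun _ : Fin (n + 1) => ν) 0).symm
  have h1 := h.integral_comp' (g := φ)
  rw [← h1]
  have h2 : Integrable (fun z => φ ((MeasurableEquiv.piFinSuccAbove (fun _ => α) 0).symm z))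
      (ν.prod (Measure.pi fun _ : Fin n => ν)) :=
    (h.integrable_comp_emb (MeasurableEquiv.measurableEmbedding _)).2 hφ
  rw [integral_prod_symm _ h2]
  simp [MeasurableEquiv.piFinSuccAbove_symm_apply, Fin.insertNthEquiv]

lemma integrable_of_bounded_differences {n : ℕ} {f : (Fin n → α) → ℝ} {c : ℝ}
    (hfm : Measurable f) (hf : ∀ x i a, |f (Function.update x i a) - f x| ≤ c) (t u : ℝ)
    (μ : Measure (Fin n → α)) [IsFiniteMeasure μ] :
    Integrable f μ ∧ Integrable (fun x => Real.exp (t * (f x - u))) μ := by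
  rcases isEmpty_or_nonempty (Fin n → α) with hE | ⟨⟨x₀⟩⟩
  · rw [Measure.eq_zero_of_isEmpty μ]
    exact ⟨integrable_zero_measure, integrable_zero_measure⟩
  have hb : ∀ x, |f x| ≤ |f x₀| + n * c := fun x => by
    have := abs_sub_le_of_bounded_differences hf x x₀
    linarith [abs_sub_abs_le_abs_sub (f x) (f x₀)]
  refine ⟨Integrable.of_bound hfm.aestronglyMeasurable _ (ae_of_all _ hb),
    Integrable.of_bound (by fun_prop) (Real.exp (|t| * (|f x₀| + n * c + |u|)))
      (ae_of_all _ fun x => ?_)⟩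
  rw [Real.norm_eq_abs, Real.abs_exp, Real.exp_le_exp]
  refine (le_abs_self _).trans ?_
  rw [abs_mul]
  gcongr
  linarith [abs_sub (f x) u, hb x]

/-- The moment generating function bound behind McDiarmid's inequality. -/
lemma integral_exp_le_of_bounded_differences {c : ℝ} (hc : 0 ≤ c)
    (t : ℝ) : ∀ (n : ℕ) (f : (Fin n → α) → ℝ), Measurable f →
    (∀ x i a, |f (Function.update x i a) - f x| ≤ c) →
    ∫ x, Real.exp (t * (f x - ∫ y, f y ∂(Measure.pi fun _ => ν))) ∂(Measure.pi fun _ : Fin n => ν) ≤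
      Real.exp (n * (c ^ 2 * t ^ 2 / 2))
  | 0, f, _, _ => by
    have h : ∀ x : Fin 0 → α, f x = f finZeroElim := fun x => congrArg f (Subsingleton.elim _ _)
    simp [h]
  | n + 1, f, hfm, hf => by
    have hcons : Measurable fun z : (Fin n → α) × α => (Fin.cons z.2 z.1 : Fin (n + 1) → α) := by
      refine measurable_pi_iff.2 fun i => ?_
      refine Fin.cases ?_ (fun i => ?_) i
      · exact measurable_snd
      · exact (measurable_pi_apply i).comp measurable_fst
    -- Integrating out the first coordinate preserves the bounded differences, so the induction
    -- applies to `g`; the remaining fluctuation in that coordinate is controlled by Hoeffding's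
    -- lemma.
    set g : (Fin n → α) → ℝ := fun y => ∫ a, f (Fin.cons a y) ∂ν with hg
    have hgm : Measurable g :=
      ((hfm.comp hcons).stronglyMeasurable.integral_prod_right' (ν := ν)).measurable
    obtain ⟨a₀⟩ : Nonempty α := nonempty_of_isProbabilityMeasure ν
    have hfa : ∀ y a, |f (Fin.cons a y) - f (Fin.cons a₀ y)| ≤ c := fun y a => by
      have := hf (Fin.cons a₀ y) 0 a
      rwa [Fin.update_cons_zero] at this
    have hfy : ∀ y, Measurable fun a => f (Fin.cons a y) := fun y =>
      hfm.comp (hcons.comp (measurable_const.prodMk measurable_id))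
    have hfyi : ∀ y, Integrable (fun a => f (Fin.cons a y)) ν := fun y => by
      refine Integrable.of_bound (hfy y).aestronglyMeasurable (|f (Fin.cons a₀ y)| + c)
        (ae_of_all _ fun a => ?_)
      rw [Real.norm_eq_abs]
      linarith [hfa y a, abs_sub_abs_le_abs_sub (f (Fin.cons a y)) (f (Fin.cons a₀ y))]
    have hgd : ∀ y i a, |g (Function.update y i a) - g y| ≤ c := fun y i a => by
      rw [hg, ← integral_sub (hfyi _) (hfyi _), ← Real.norm_eq_abs]
      refine (norm_integral_le_of_norm_le_const (C := c) (ae_of_all _ fun b => ?_)).trans (by simp)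
      rw [Fin.cons_update]
      exact hf _ _ _
    have ih := integral_exp_le_of_bounded_differences hc t n g hgm hgd
    have hEf : ∫ x, f x ∂(Measure.pi fun _ => ν) = ∫ y, g y ∂(Measure.pi fun _ : Fin n => ν) :=
      integral_pi_succ ν (integrable_of_bounded_differences hfm hf 0 0 _).1
    set E := ∫ y, g y ∂(Measure.pi fun _ : Fin n => ν) with hE
    rw [hEf, integral_pi_succ ν (integrable_of_bounded_differences hfm hf t E _).2]
    have hinner : ∀ y, ∫ a, Real.exp (t * (f (Fin.cons a y) - E)) ∂ν ≤
        Real.exp (t * (g y - E)) * Real.exp (c ^ 2 * t ^ 2 / 2) := fun y => by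
      -- The interval around the value at `a₀` has length `2 * c`, hence the variance proxy `c ^ 2`.
      have h1 := (hasSubgaussianMGF_of_mem_Icc (μ := ν) (X := fun a => f (Fin.cons a y))
        (a := f (Fin.cons a₀ y) - c) (b := f (Fin.cons a₀ y) + c) (hfy y).aemeasurable
        (ae_of_all _ fun a => by
          have := abs_le.1 (hfa y a)
          constructor <;> linarith)).mgf_le t
      have h2 : (((‖f (Fin.cons a₀ y) + c - (f (Fin.cons a₀ y) - c)‖₊ / 2) ^ 2 : NNReal) : ℝ) =
          c ^ 2 := by
        push_cast
        rw [Real.norm_eq_abs, div_pow, sq_abs]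
        ring
      rw [h2, mgf] at h1
      calc ∫ a, Real.exp (t * (f (Fin.cons a y) - E)) ∂ν
          = ∫ a, Real.exp (t * (g y - E)) * Real.exp (t * (f (Fin.cons a y) - g y)) ∂ν := by
            refine integral_congr_ae (ae_of_all _ fun a => ?_)
            simp only
            rw [← Real.exp_add]
            ring_nf
        _ = Real.exp (t * (g y - E)) * ∫ a, Real.exp (t * (f (Fin.cons a y) - g y)) ∂ν :=
            integral_const_mul _ _
        _ ≤ _ := by gcongr
    calc ∫ y, ∫ a, Real.exp (t * (f (Fin.cons a y) - E)) ∂ν ∂(Measure.pi fun _ : Fin n => ν)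
        ≤ ∫ y, Real.exp (t * (g y - E)) * Real.exp (c ^ 2 * t ^ 2 / 2)
            ∂(Measure.pi fun _ : Fin n => ν) :=
          integral_mono_of_nonneg
            (ae_of_all _ fun y => integral_nonneg fun a => (Real.exp_pos _).le)
            ((integrable_of_bounded_differences hgm hgd t E _).2.mul_const _)
            (ae_of_all _ hinner)
      _ = (∫ y, Real.exp (t * (g y - E)) ∂(Measure.pi fun _ : Fin n => ν)) *
            Real.exp (c ^ 2 * t ^ 2 / 2) := integral_mul_const _ _
      _ ≤ Real.exp (n * (c ^ 2 * t ^ 2 / 2)) * Real.exp (c ^ 2 * t ^ 2 / 2) := by gcongr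
      _ = _ := by
        rw [← Real.exp_add]
        congr 1
        push_cast
        ring

/-- **McDiarmid's inequality** (with a nonoptimal constant) for identically distributed
independent coordinates. -/
lemma measureReal_ge_le_of_bounded_differences {n : ℕ} {c u : ℝ} (hc : 0 ≤ c) (hu : 0 ≤ u)
    {f : (Fin n → α) → ℝ} (hfm : Measurable f)
    (hf : ∀ x i a, |f (Function.update x i a) - f x| ≤ c) :
    (Measure.pi fun _ : Fin n => ν).real
      {x | u ≤ |f x - ∫ y, f y ∂(Measure.pi fun _ : Fin n => ν)|} ≤
        2 * Real.exp (-u ^ 2 / (2 * (n * c ^ 2))) := by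
  set μ := Measure.pi fun _ : Fin n => ν with hμ
  have hn : 0 ≤ (n : ℝ) * c ^ 2 := by positivity
  have hsub : HasSubgaussianMGF (fun x => f x - ∫ y, f y ∂μ) ((n : ℝ) * c ^ 2).toNNReal μ := by
    refine ⟨fun t => (integrable_of_bounded_differences hfm hf t _ μ).2, fun t => ?_⟩
    have := integral_exp_le_of_bounded_differences ν hc t n f hfm hf
    rw [Real.coe_toNNReal _ hn]
    refine this.trans_eq ?_
    ring_nf
  have h1 := hsub.measure_ge_le hu
  have h2 := hsub.neg.measure_ge_le hu
  rw [Real.coe_toNNReal _ hn] at h1 h2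
  have h3 : {x | u ≤ |f x - ∫ y, f y ∂μ|} ⊆ {x | u ≤ f x - ∫ y, f y ∂μ} ∪
      {x | u ≤ (-fun x => f x - ∫ y, f y ∂μ) x} := fun x hx => by
    simp only [Set.mem_union, Set.mem_ofPred_eq, Pi.neg_apply] at hx ⊢
    exact le_abs.1 hx
  calc _ ≤ _ := measureReal_mono h3
    _ ≤ _ := measureReal_union_le _ _
    _ ≤ _ := by linarith

end BoundedDifferences

/-! ### The sign function -/

section Sign

lemma measurable_sign : Measurable Real.sign := by
  unfold Real.sign
  exact Measurable.ite measurableSet_Iio measurable_const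
    (Measurable.ite measurableSet_Ioi measurable_const measurable_const)

lemma abs_sign_le_one (x : ℝ) : |Real.sign x| ≤ 1 := by
  rcases Real.sign_apply_eq x with h | h | h <;> simp [h]

lemma abs_sign_mul_sign_le_one (x y : ℝ) : |Real.sign x * Real.sign y| ≤ 1 := by
  rw [abs_mul]
  exact mul_le_one₀ (abs_sign_le_one x) (abs_nonneg _) (abs_sign_le_one y)

lemma sign_pos_mul {c : ℝ} (hc : 0 < c) (x : ℝ) : Real.sign (c * x) = Real.sign x := by
  rcases lt_trichotomy x 0 with h | h | h
  · rw [Real.sign_of_neg h, Real.sign_of_neg (mul_neg_of_pos_of_neg hc h)]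
  · simp [h]
  · rw [Real.sign_of_pos h, Real.sign_of_pos (mul_pos hc h)]

lemma sign_mul_sign (x y : ℝ) : Real.sign (x * y) = Real.sign x * Real.sign y := by
  rcases lt_trichotomy x 0 with h | h | h
  · rw [Real.sign_of_neg h, show x * y = -((-x) * y) by ring, Real.sign_neg,
      sign_pos_mul (neg_pos.2 h), neg_one_mul]
  · simp [h]
  · rw [Real.sign_of_pos h, sign_pos_mul h, one_mul]

end Sign

/-! ### Gaussian sign products in polar coordinates -/

section Angle

open Real intervalIntegral

/-- Both signs flip under a shift by `π`, so the product has period `π`. On one period it is `-1` on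
an arc of length `α` and `1` on the remaining `π - α`. -/
lemma integral_sign_cos_mul_sign_cos_sub {α : ℝ} (h0 : 0 ≤ α) (hπ : α ≤ π) :
    ∫ θ in (-π)..π, Real.sign (cos θ) * Real.sign (cos (θ - α)) = 2 * π - 4 * α := by
  set F : ℝ → ℝ := fun θ => Real.sign (cos θ) * Real.sign (cos (θ - α)) with hF
  have hFm : Measurable F := (measurable_sign.comp (by fun_prop)).mul
    (measurable_sign.comp (by fun_prop))
  have hint : ∀ a b, IntervalIntegrable F volume a b := fun a b =>
    (intervalIntegrable_const (c := (1 : ℝ))).mono_fun hFm.aestronglyMeasurable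
      (ae_of_all _ fun θ => by
        rw [norm_one]; exact abs_sign_mul_sign_le_one _ _)
  have hper : Function.Periodic F π := fun θ => by
    simp only [hF, cos_add_pi, show θ + π - α = θ - α + π by ring, Real.sign_neg, neg_mul_neg]
  have h1 : ∫ θ in (-π)..0, F θ = ∫ θ in (-(π / 2))..(π / 2), F θ := by
    have := hper.intervalIntegral_add_eq (-π) (-(π / 2))
    rwa [neg_add_cancel, show -(π / 2) + π = π / 2 by ring] at this
  have h2 : ∫ θ in (0 : ℝ)..π, F θ = ∫ θ in (-(π / 2))..(π / 2), F θ := by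
    have := hper.intervalIntegral_add_eq 0 (-(π / 2))
    rwa [zero_add, show -(π / 2) + π = π / 2 by ring] at this
  have h3 : ∫ θ in (-(π / 2))..(α - π / 2), F θ = ∫ θ in (-(π / 2))..(α - π / 2), (-1 : ℝ) := by
    refine integral_congr_Ioo_of_le (by linarith) fun θ hθ => ?_
    have hc1 : 0 < cos θ := cos_pos_of_mem_Ioo ⟨hθ.1, by linarith [hθ.2]⟩
    have hc2 : cos (θ - α) < 0 := by
      rw [← cos_neg]
      exact cos_neg_of_pi_div_two_lt_of_lt (by linarith [hθ.2]) (by linarith [hθ.1])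
    simp only [hF]
    rw [Real.sign_of_pos hc1, Real.sign_of_neg hc2, one_mul]
  have h4 : ∫ θ in (α - π / 2)..(π / 2), F θ = ∫ θ in (α - π / 2)..(π / 2), (1 : ℝ) := by
    refine integral_congr_Ioo_of_le (by linarith) fun θ hθ => ?_
    have hc1 : 0 < cos θ := cos_pos_of_mem_Ioo ⟨by linarith [hθ.1], hθ.2⟩
    have hc2 : 0 < cos (θ - α) :=
      cos_pos_of_mem_Ioo ⟨by linarith [hθ.1], by linarith [hθ.2]⟩
    simp only [hF]
    rw [Real.sign_of_pos hc1, Real.sign_of_pos hc2, one_mul]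
  rw [← integral_add_adjacent_intervals (hint (-π) 0) (hint 0 π), h1, h2,
    ← integral_add_adjacent_intervals (hint (-(π / 2)) (α - π / 2)) (hint (α - π / 2) (π / 2)),
    h3, h4, intervalIntegral.integral_const, intervalIntegral.integral_const]
  simp only [smul_eq_mul]
  ring

/-- The mean of a rotation-equivariant bounded function under the standard Gaussian law on the
plane, in polar coordinates. -/
lemma integral_prod_gaussianReal_eq_angle {g : ℝ × ℝ → ℝ} {F : ℝ → ℝ}
    (hg : ∀ r θ : ℝ, 0 < r → g (r * cos θ, r * sin θ) = F θ) :
    ∫ z, g z ∂((gaussianReal 0 1).prod (gaussianReal 0 1)) =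
      (2 * π)⁻¹ * ∫ θ in (-π)..π, F θ := by
  have hd : (gaussianReal 0 1).prod (gaussianReal 0 1) =
      (volume : Measure (ℝ × ℝ)).withDensity fun z => gaussianPDF 0 1 z.1 * gaussianPDF 0 1 z.2 := by
    rw [gaussianReal_of_var_ne_zero 0 one_ne_zero,
      prod_withDensity (measurable_gaussianPDF 0 1) (measurable_gaussianPDF 0 1)]
    rfl
  have hpdf : ∀ z : ℝ × ℝ, (gaussianPDF 0 1 z.1 * gaussianPDF 0 1 z.2).toReal =
      (2 * π)⁻¹ * exp (-(1 / 2) * (z.1 ^ 2 + z.2 ^ 2)) := fun z => by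
    rw [ENNReal.toReal_mul, toReal_gaussianPDF, toReal_gaussianPDF, gaussianPDFReal,
      gaussianPDFReal]
    simp only [NNReal.coe_one, mul_one, sub_zero]
    rw [mul_mul_mul_comm, ← mul_inv, ← exp_add, mul_self_sqrt (by positivity)]
    ring_nf
  -- The radial factor has mass one, so only the uniform average over the angle survives.
  have hr : ∫ r in Set.Ioi (0 : ℝ), r * exp (-(1 / 2) * r ^ 2) = 1 := by
    have h := integral_mul_cexp_neg_mul_sq (b := 1 / 2) (by norm_num)
    have h2 : ∀ r : ℝ, (r : ℂ) * Complex.exp (-(1 / 2) * (r : ℂ) ^ 2) =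
        ((r * exp (-(1 / 2) * r ^ 2) : ℝ) : ℂ) := fun r => by push_cast; rfl
    simp_rw [h2] at h
    rw [integral_complex_ofReal] at h
    norm_num at h
    norm_num
    exact_mod_cast h
  have hm : Measurable fun z : ℝ × ℝ => gaussianPDF 0 1 z.1 * gaussianPDF 0 1 z.2 :=
    ((measurable_gaussianPDF 0 1).comp measurable_fst).mul
      ((measurable_gaussianPDF 0 1).comp measurable_snd)
  rw [hd, integral_withDensity_eq_integral_toReal_smul hm
    (ae_of_all _ fun z => ENNReal.mul_lt_top gaussianPDF_lt_top gaussianPDF_lt_top)]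
  simp_rw [hpdf]
  rw [← integral_comp_polarCoord_symm, polarCoord_target]
  have h5 : ∀ z ∈ Set.Ioi (0 : ℝ) ×ˢ Set.Ioo (-π) π,
      z.1 • (fun z : ℝ × ℝ => ((2 * π)⁻¹ * exp (-(1 / 2) * (z.1 ^ 2 + z.2 ^ 2))) • g z)
        (polarCoord.symm z) = (z.1 * exp (-(1 / 2) * z.1 ^ 2)) * ((2 * π)⁻¹ * F z.2) := by
    intro z hz
    have hz1 : 0 < z.1 := hz.1
    rw [polarCoord_symm_apply]
    simp only [smul_eq_mul]
    rw [hg _ _ hz1, show (z.1 * cos z.2) ^ 2 + (z.1 * sin z.2) ^ 2 = z.1 ^ 2 by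
      rw [mul_pow, mul_pow, ← mul_add, cos_sq_add_sin_sq, mul_one]]
    ring
  rw [setIntegral_congr_fun (measurableSet_Ioi.prod measurableSet_Ioo) h5, Measure.volume_eq_prod,
    setIntegral_prod_mul (fun r : ℝ => r * exp (-(1 / 2) * r ^ 2)) (fun θ => (2 * π)⁻¹ * F θ),
    hr, one_mul, MeasureTheory.integral_const_mul, intervalIntegral.integral_of_le (by linarith [pi_pos]),
    integral_Ioc_eq_integral_Ioo]

lemma integral_sign_mul_sign_gaussian {α : ℝ} (h0 : 0 ≤ α) (hπ : α ≤ π) :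
    ∫ z : ℝ × ℝ, Real.sign z.1 * Real.sign (cos α * z.1 + sin α * z.2)
      ∂((gaussianReal 0 1).prod (gaussianReal 0 1)) = 1 - 2 * α / π := by
  rw [integral_prod_gaussianReal_eq_angle
    (F := fun θ => Real.sign (cos θ) * Real.sign (cos (θ - α))),
    integral_sign_cos_mul_sign_cos_sub h0 hπ]
  · field_simp
    ring
  · intro r θ hr
    simp only
    rw [sign_pos_mul hr, cos_sub, show cos α * (r * cos θ) + sin α * (r * sin θ) =
      r * (cos θ * cos α + sin θ * sin α) by ring, sign_pos_mul hr]

end Angle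

/-! ### Sheppard's formula -/

section Orthant

/-- Two laws in the plane with the same linear images agree. -/
lemma ext_of_map_linear {μ μ' : Measure (ℝ × ℝ)} [IsFiniteMeasure μ] [IsFiniteMeasure μ']
    (h : ∀ a b : ℝ, μ.map (fun z => a * z.1 + b * z.2) = μ'.map (fun z => a * z.1 + b * z.2)) :
    μ = μ' := by
  refine Measure.ext_of_charFunDual (funext fun L => ?_)
  have hL : ⇑L = fun z : ℝ × ℝ => L (1, 0) * z.1 + L (0, 1) * z.2 := by
    ext z
    have : z = z.1 • ((1, 0) : ℝ × ℝ) + z.2 • ((0, 1) : ℝ × ℝ) := by ext <;> simp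
    conv_lhs => rw [this, map_add, map_smul, map_smul]
    simp only [smul_eq_mul]
    ring
  rw [charFunDual_eq_charFun_map_one, charFunDual_eq_charFun_map_one, hL, h]

lemma map_linear_prod_gaussianReal (a b : ℝ) :
    ((gaussianReal 0 1).prod (gaussianReal 0 1)).map (fun z => a * z.1 + b * z.2) =
      gaussianReal 0 (a ^ 2 + b ^ 2).toNNReal := by
  have h1 : HasLaw (fun z : ℝ × ℝ => z.1) (gaussianReal 0 1)
      ((gaussianReal 0 1).prod (gaussianReal 0 1)) := measurePreserving_fst.hasLaw
  have h2 : HasLaw (fun z : ℝ × ℝ => z.2) (gaussianReal 0 1)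
      ((gaussianReal 0 1).prod (gaussianReal 0 1)) := measurePreserving_snd.hasLaw
  have h := gaussianReal_add_gaussianReal_of_indepFun
    (indepFun_prod (μ := gaussianReal 0 1) (ν := gaussianReal 0 1)
      (X := fun x => a * x) (Y := fun x => b * x) (by fun_prop) (by fun_prop))
    (gaussianReal_const_mul h1 a).map_eq (gaussianReal_const_mul h2 b).map_eq
  simp only [mul_zero, add_zero, mul_one] at h
  refine Eq.trans h ?_
  congr 1
  ext
  rw [Real.coe_toNNReal _ (by positivity)]
  rfl

/-- **Sheppard's formula**: the mean of the product of the signs of two centered jointly Gaussian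
variables with equal variances `v` and correlation `r`. -/
lemma integral_sign_mul_sign_eq {Ω : Type*} [MeasurableSpace Ω] {P : Measure Ω}
    [IsProbabilityMeasure P] {U V : Ω → ℝ} (hU : Measurable U) (hV : Measurable V) {v r : ℝ}
    (hv : 0 < v) (hr : |r| ≤ 1)
    (h : ∀ a b : ℝ, P.map (fun ω => a * U ω + b * V ω) =
      gaussianReal 0 (v * (a ^ 2 + b ^ 2 + 2 * (a * b * r))).toNNReal) :
    ∫ ω, Real.sign (U ω) * Real.sign (V ω) ∂P = 2 / Real.pi * Real.arcsin r := by
  obtain ⟨hr1, hr2⟩ := abs_le.1 hr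
  set α := Real.arccos r with hα
  have hcos : Real.cos α = r := Real.cos_arccos hr1 hr2
  -- With `cos α = r`, `G` sends a standard Gaussian pair to one with the law of `(U, V)`. The scale
  -- `√v` does not affect signs.
  set G : ℝ × ℝ → ℝ × ℝ := fun z => (√v * z.1, √v * (Real.cos α * z.1 + Real.sin α * z.2)) with hG
  have hGm : Measurable G := by fun_prop
  have hUV : Measurable fun ω => (U ω, V ω) := hU.prodMk hV
  have hlaw : P.map (fun ω => (U ω, V ω)) =
      ((gaussianReal 0 1).prod (gaussianReal 0 1)).map G := by
    have : IsProbabilityMeasure (P.map fun ω => (U ω, V ω)) :=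
      Measure.isProbabilityMeasure_map hUV.aemeasurable
    have : IsProbabilityMeasure (((gaussianReal 0 1).prod (gaussianReal 0 1)).map G) :=
      Measure.isProbabilityMeasure_map hGm.aemeasurable
    refine ext_of_map_linear fun a b => ?_
    rw [Measure.map_map (by fun_prop) hUV, Measure.map_map (by fun_prop) hGm]
    refine (h a b).trans ?_
    have h2 : (fun z : ℝ × ℝ => a * z.1 + b * z.2) ∘ G =
        fun z => (√v * (a + b * Real.cos α)) * z.1 + (√v * (b * Real.sin α)) * z.2 := by
      ext z
      simp only [hG, Function.comp_apply]
      ring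
    rw [h2, map_linear_prod_gaussianReal]
    congr 2
    rw [mul_pow, mul_pow, Real.sq_sqrt hv.le, mul_pow, Real.sin_sq, hcos]
    ring
  have hsm : Measurable fun z : ℝ × ℝ => Real.sign z.1 * Real.sign z.2 :=
    (measurable_sign.comp measurable_fst).mul (measurable_sign.comp measurable_snd)
  have hint : ∫ ω, Real.sign (U ω) * Real.sign (V ω) ∂P = 1 - 2 * α / Real.pi := by
    rw [← integral_sign_mul_sign_gaussian (Real.arccos_nonneg r) (Real.arccos_le_pi r)]
    have h3 := integral_map (μ := P) hUV.aemeasurable (f := fun z => Real.sign z.1 * Real.sign z.2)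
      hsm.aestronglyMeasurable
    rw [← h3, hlaw, integral_map hGm.aemeasurable hsm.aestronglyMeasurable]
    simp only [hG, sign_pos_mul (Real.sqrt_pos.2 hv)]
    rfl
  have hπ := Real.pi_ne_zero
  rw [hint, hα, Real.arccos_eq_pi_div_two_sub_arcsin]
  field_simp
  ring

end Orthant

/-! ### Concentration of averages over triples -/

/-- The average of a kernel of order three over all triples of observations. -/
noncomputable def tripleMean {α : Type*} {n : ℕ} (H : α → α → α → ℝ) (x : Fin n → α) : ℝ :=
  (∑ k, ∑ l, ∑ m, H (x k) (x l) (x m)) / (n : ℝ) ^ 3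

section TripleMean

variable {α : Type*} {n : ℕ} {H : α → α → α → ℝ}

lemma abs_tripleMean_le (hH : ∀ a b c, |H a b c| ≤ 1) (x : Fin n → α) : |tripleMean H x| ≤ 1 := by
  rw [tripleMean, abs_div, abs_of_nonneg (by positivity : (0 : ℝ) ≤ (n : ℝ) ^ 3)]
  refine div_le_one_of_le₀ ?_ (by positivity)
  calc |∑ k, ∑ l, ∑ m, H (x k) (x l) (x m)| ≤ ∑ k : Fin n, ∑ l : Fin n, ∑ m : Fin n, (1 : ℝ) := by
        refine (Finset.abs_sum_le_sum_abs _ _).trans (Finset.sum_le_sum fun k _ => ?_)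
        refine (Finset.abs_sum_le_sum_abs _ _).trans (Finset.sum_le_sum fun l _ => ?_)
        exact (Finset.abs_sum_le_sum_abs _ _).trans (Finset.sum_le_sum fun m _ => hH _ _ _)
    _ = (n : ℝ) ^ 3 := by simp; ring

/-- A triple array whose entries are dominated by three diagonal-type indicators has a small
average. -/
lemma abs_sum_triple_div_le {D : Fin n → Fin n → Fin n → ℝ} {e₁ e₂ e₃ : Fin n → Fin n → Fin n → ℝ}
    (hD : ∀ k l m, |D k l m| ≤ 2 * (e₁ k l m + e₂ k l m + e₃ k l m))
    (h₁ : ∑ k, ∑ l, ∑ m, e₁ k l m = (n : ℝ) ^ 2) (h₂ : ∑ k, ∑ l, ∑ m, e₂ k l m = (n : ℝ) ^ 2)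
    (h₃ : ∑ k, ∑ l, ∑ m, e₃ k l m = (n : ℝ) ^ 2) :
    |(∑ k, ∑ l, ∑ m, D k l m) / (n : ℝ) ^ 3| ≤ 6 / n := by
  have h : |∑ k, ∑ l, ∑ m, D k l m| ≤ 6 * (n : ℝ) ^ 2 := by
    calc |∑ k, ∑ l, ∑ m, D k l m|
        ≤ ∑ k, ∑ l, ∑ m, 2 * (e₁ k l m + e₂ k l m + e₃ k l m) := by
          refine (Finset.abs_sum_le_sum_abs _ _).trans (Finset.sum_le_sum fun k _ => ?_)
          refine (Finset.abs_sum_le_sum_abs _ _).trans (Finset.sum_le_sum fun l _ => ?_)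
          exact (Finset.abs_sum_le_sum_abs _ _).trans (Finset.sum_le_sum fun m _ => hD _ _ _)
      _ = 2 * (∑ k, ∑ l, ∑ m, e₁ k l m + ∑ k, ∑ l, ∑ m, e₂ k l m + ∑ k, ∑ l, ∑ m, e₃ k l m) := by
          simp only [← Finset.mul_sum, Finset.sum_add_distrib]
      _ = 6 * (n : ℝ) ^ 2 := by rw [h₁, h₂, h₃]; ring
  rcases Nat.eq_zero_or_pos n with rfl | hn
  · simp
  have hn' : (0 : ℝ) < n := by exact_mod_cast hn
  rw [abs_div, abs_of_pos (by positivity : (0 : ℝ) < (n : ℝ) ^ 3), div_le_div_iff₀ (by positivity) hn']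
  nlinarith

lemma tripleMean_bounded_differences (hH : ∀ a b c, |H a b c| ≤ 1) (x : Fin n → α) (i : Fin n)
    (a : α) : |tripleMean H (Function.update x i a) - tripleMean H x| ≤ 6 / n := by
  simp only [tripleMean]
  rw [← sub_div, ← Finset.sum_sub_distrib]
  simp only [← Finset.sum_sub_distrib]
  -- Only triples containing the index `i` change, each by at most 2.
  refine abs_sum_triple_div_le (e₁ := fun k _ _ => if k = i then 1 else 0)
    (e₂ := fun _ l _ => if l = i then 1 else 0) (e₃ := fun _ _ m => if m = i then 1 else 0)
    (fun k l m => ?_) (by simp [sq]) (by simp [sq]) (by simp [sq])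
  have h2 : ∀ a b c a' b' c', |H a b c - H a' b' c'| ≤ 2 := fun a b c a' b' c' => by
    linarith [abs_sub (H a b c) (H a' b' c'), hH a b c, hH a' b' c']
  by_cases hk : k = i
  · refine (h2 _ _ _ _ _ _).trans ?_
    simp only [if_pos hk]
    split_ifs <;> norm_num
  by_cases hl : l = i
  · refine (h2 _ _ _ _ _ _).trans ?_
    simp only [if_pos hl]
    split_ifs <;> norm_num
  by_cases hm : m = i
  · refine (h2 _ _ _ _ _ _).trans ?_
    simp only [if_pos hm, if_neg hk, if_neg hl]
    norm_num
  simp [Function.update_of_ne, hk, hl, hm]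

variable [MeasurableSpace α] (ν : Measure α) [IsProbabilityMeasure ν]

lemma measurable_kernel_eval (hHm : Measurable fun z : α × α × α => H z.1 z.2.1 z.2.2)
    (k l m : Fin n) : Measurable fun x : Fin n → α => H (x k) (x l) (x m) := by
  have h : Measurable fun x : Fin n → α => (x k, x l, x m) :=
    (measurable_pi_apply k).prodMk ((measurable_pi_apply l).prodMk (measurable_pi_apply m))
  exact hHm.comp h

lemma measurable_tripleMean (hHm : Measurable fun z : α × α × α => H z.1 z.2.1 z.2.2) :
    Measurable fun x : Fin n → α => tripleMean H x := by
  refine Measurable.div_const ?_ _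
  refine Finset.measurable_sum _ fun k _ => Finset.measurable_sum _ fun l _ =>
    Finset.measurable_sum _ fun m _ => measurable_kernel_eval hHm k l m

/-- The bias of a triple average caused by repeated indices. -/
lemma abs_integral_tripleMean_sub_le (hn : 0 < n) (hH : ∀ a b c, |H a b c| ≤ 1)
    (hHm : Measurable fun z : α × α × α => H z.1 z.2.1 z.2.2) {θ : ℝ} (hθ1 : |θ| ≤ 1)
    (hθ : ∀ k l m : Fin n, k ≠ l → k ≠ m → l ≠ m →
      ∫ x, H (x k) (x l) (x m) ∂(Measure.pi fun _ : Fin n => ν) = θ) :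
    |∫ x, tripleMean H x ∂(Measure.pi fun _ : Fin n => ν) - θ| ≤ 6 / n := by
  set μ := Measure.pi fun _ : Fin n => ν with hμ
  have hn' : (0 : ℝ) < n := by exact_mod_cast hn
  have hint : ∀ k l m : Fin n, Integrable (fun x : Fin n → α => H (x k) (x l) (x m)) μ :=
    fun k l m => Integrable.of_bound (measurable_kernel_eval hHm k l m).aestronglyMeasurable 1
      (ae_of_all _ fun x => hH _ _ _)
  have h1 : ∫ x, tripleMean H x ∂μ - θ =
      (∑ k, ∑ l, ∑ m, (∫ x, H (x k) (x l) (x m) ∂μ - θ)) / (n : ℝ) ^ 3 := by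
    simp only [tripleMean]
    rw [integral_div, integral_finsetSum _ fun k _ => integrable_finsetSum _ fun l _ =>
      integrable_finsetSum _ fun m _ => hint k l m]
    simp_rw [integral_finsetSum _ fun l _ => integrable_finsetSum _ fun m _ => hint _ l m,
      integral_finsetSum _ fun m _ => hint _ _ m]
    simp only [Finset.sum_sub_distrib, Finset.sum_const, Finset.card_univ, Fintype.card_fin,
      nsmul_eq_mul]
    field_simp
  rw [h1]
  -- Triples of distinct indices have mean exactly `θ`; only those with a coincidence contribute.
  refine abs_sum_triple_div_le (e₁ := fun k l _ => if k = l then 1 else 0)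
    (e₂ := fun k _ m => if k = m then 1 else 0) (e₃ := fun _ l m => if l = m then 1 else 0)
    (fun k l m => ?_) (by simp [sq]) (by simp [sq]) (by simp [sq])
  have h2 : |∫ x, H (x k) (x l) (x m) ∂μ - θ| ≤ 2 := by
    have h3 : |∫ x, H (x k) (x l) (x m) ∂μ| ≤ 1 := by
      rw [← Real.norm_eq_abs]
      exact (norm_integral_le_of_norm_le_const (C := 1) (ae_of_all _ fun x => hH _ _ _)).trans
        (by simp)
    linarith [abs_sub (∫ x, H (x k) (x l) (x m) ∂μ) θ]
  by_cases hkl : k = l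
  · refine h2.trans ?_
    simp only [if_pos hkl]
    split_ifs <;> norm_num
  by_cases hkm : k = m
  · refine h2.trans ?_
    simp only [if_pos hkm]
    split_ifs <;> norm_num
  by_cases hlm : l = m
  · refine h2.trans ?_
    simp only [if_pos hlm, if_neg hkl, if_neg hkm]
    norm_num
  simp [hkl, hkm, hlm, hθ k l m hkl hkm hlm]

/-- Concentration of a triple average around the mean of the kernel. -/
lemma measureReal_tripleMean_le (hn : 0 < n) (hH : ∀ a b c, |H a b c| ≤ 1)
    (hHm : Measurable fun z : α × α × α => H z.1 z.2.1 z.2.2) {θ : ℝ} (hθ1 : |θ| ≤ 1)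
    (hθ : ∀ k l m : Fin n, k ≠ l → k ≠ m → l ≠ m →
      ∫ x, H (x k) (x l) (x m) ∂(Measure.pi fun _ : Fin n => ν) = θ) {u : ℝ} (hu : 0 ≤ u) :
    (Measure.pi fun _ : Fin n => ν).real {x | u + 6 / n ≤ |tripleMean H x - θ|} ≤
      2 * Real.exp (-(n * u ^ 2) / 72) := by
  have hn' : (0 : ℝ) < n := by exact_mod_cast hn
  have h1 := measureReal_ge_le_of_bounded_differences ν (n := n) (c := 6 / n) (u := u)
    (by positivity) hu (measurable_tripleMean hHm) (tripleMean_bounded_differences hH)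
  have h2 := abs_integral_tripleMean_sub_le ν hn hH hHm hθ1 hθ
  refine (measureReal_mono fun x hx => ?_).trans (h1.trans_eq ?_)
  · simp only [Set.mem_ofPred_eq] at hx ⊢
    linarith [abs_sub_le (tripleMean H x)
      (∫ x, tripleMean H x ∂(Measure.pi fun _ : Fin n => ν)) θ]
  · congr 2
    field_simp
    ring

end TripleMean

/-! ### Rank statistics as triple averages -/

section Ranks

variable {n p : ℕ} {x : Fin n → Fin p → ℝ} {i j : Fin p}

lemma sum_sum_sign_sub_eq_zero (a : Fin n → ℝ) : ∑ k, ∑ l, Real.sign (a k - a l) = 0 := by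
  have h : ∑ k, ∑ l, Real.sign (a k - a l) = -∑ k, ∑ l, Real.sign (a k - a l) := by
    conv_lhs => rw [Finset.sum_comm]
    simp only [← Finset.sum_neg_distrib, ← Real.sign_neg, neg_sub]
  linarith

lemma two_mul_rank_sub (hx : Function.Injective fun k => x k j) (k : Fin n) :
    2 * rank x k j - (n + 1) = ∑ l, Real.sign (x k j - x l j) := by
  -- The last term corrects `l = k`, where the rank counts the observation itself but the sign is
  -- zero.
  have h1 : ∀ l, Real.sign (x k j - x l j) =
      2 * (if x l j ≤ x k j then 1 else 0) - 1 - (if l = k then 1 else 0) := by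
    intro l
    by_cases hlk : l = k
    · subst hlk; simp; norm_num
    rcases lt_trichotomy (x l j) (x k j) with h | h | h
    · rw [Real.sign_of_pos (sub_pos.2 h)]; simp [h.le, hlk]; norm_num
    · exact absurd (hx h) hlk
    · rw [Real.sign_of_neg (sub_neg.2 h)]; simp [h.not_ge, hlk]
  simp_rw [h1, Finset.sum_sub_distrib, ← Finset.mul_sum]
  simp [rank]
  ring

lemma rankMean_eq (hn : 0 < n) (hx : Function.Injective fun k => x k j) :
    rankMean x j = (n + 1) / 2 := by
  have hn' : (n : ℝ) ≠ 0 := by positivity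
  have h := sum_sum_sign_sub_eq_zero fun k => x k j
  simp_rw [← two_mul_rank_sub hx, Finset.sum_sub_distrib, ← Finset.mul_sum] at h
  simp only [Finset.sum_const, Finset.card_univ, Fintype.card_fin, nsmul_eq_mul] at h
  rw [rankMean]
  field_simp
  linarith

lemma rank_sub_rankMean (hn : 0 < n) (hx : Function.Injective fun k => x k j) (k : Fin n) :
    rank x k j - rankMean x j = (∑ l, Real.sign (x k j - x l j)) / 2 := by
  rw [rankMean_eq hn hx, ← two_mul_rank_sub hx]
  ring

/-- Without ties the ranks are a permutation of `1, …, n`. -/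
lemma sum_comp_rank (hx : Function.Injective fun k => x k j) (g : ℝ → ℝ) :
    ∑ k, g (rank x k j) = ∑ r ∈ Finset.range n, g (r + 1) := by
  set R : Fin n → ℕ := fun k => (Finset.univ.filter fun l => x l j ≤ x k j).card with hR
  have hlt : ∀ k l, x k j < x l j → R k < R l := fun k l hkl => by
    refine Finset.card_lt_card (Finset.ssubset_iff_of_subset ?_ |>.2 ⟨l, ?_, ?_⟩)
    · intro m hm
      simp only [Finset.mem_filter, Finset.mem_univ, true_and] at hm ⊢
      exact hm.trans hkl.le
    · simp
    · simpa using hkl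
  have hinj : Function.Injective R := fun k l hkl => by
    rcases lt_trichotomy (x k j) (x l j) with h | h | h
    · exact absurd hkl (hlt k l h).ne
    · exact hx h
    · exact absurd hkl (hlt l k h).ne'
  have himg : Finset.univ.image R = (Finset.range n).image (· + 1) := by
    refine Finset.eq_of_subset_of_card_le (fun r hr => ?_) ?_
    · obtain ⟨k, -, rfl⟩ := Finset.mem_image.1 hr
      have h1 : 0 < R k := Finset.card_pos.2 ⟨k, by simp⟩
      have h2 : R k ≤ n := (Finset.card_le_univ _).trans_eq (Fintype.card_fin n)
      exact Finset.mem_image.2 ⟨R k - 1, Finset.mem_range.2 (by omega), by omega⟩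
    · rw [Finset.card_image_of_injective _ hinj,
        Finset.card_image_of_injective _ (add_left_injective 1)]
      simp
  calc ∑ k, g (rank x k j) = ∑ r ∈ Finset.univ.image R, g r :=
        (Finset.sum_image (f := fun r : ℕ => g r) fun k _ l _ h => hinj h).symm
    _ = ∑ r ∈ Finset.range n, g (r + 1) := by
        rw [himg, Finset.sum_image fun k _ l _ h => add_left_injective 1 h]
        simp

lemma sum_rank_sub_rankMean_sq (hn : 0 < n) (hx : Function.Injective fun k => x k j) :
    ∑ k, (rank x k j - rankMean x j) ^ 2 = n * ((n : ℝ) ^ 2 - 1) / 12 := by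
  rw [rankMean_eq hn hx, sum_comp_rank hx fun r => (r - (n + 1) / 2) ^ 2]
  have h : ∀ (c : ℝ) (m : ℕ), ∑ r ∈ Finset.range m, ((r : ℝ) + 1 - c) ^ 2 =
      m * (m + 1) * (2 * m + 1) / 6 - c * (m * (m + 1)) + m * c ^ 2 := by
    intro c m
    induction m with
    | zero => simp
    | succ m ih => rw [Finset.sum_range_succ, ih]; push_cast; ring
  rw [h]
  ring

/-- A centered rank is half a sum of signs, so the rank covariance is a quarter of the triple sum.
Without ties both variance sums equal `n (n² - 1) / 12`, so the normalization is deterministic. -/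
lemma spearmanRho_eq (hn : 2 ≤ n) (hi : Function.Injective fun k => x k i)
    (hj : Function.Injective fun k => x k j) :
    spearmanRho x i j = 3 * ((n : ℝ) ^ 2 / ((n : ℝ) ^ 2 - 1) * tripleMean
      (fun a b c : Fin p → ℝ => Real.sign (a i - b i) * Real.sign (a j - c j)) x) := by
  have hn0 : 0 < n := by omega
  have hn' : (2 : ℝ) ≤ n := by exact_mod_cast hn
  have hn2 : (0 : ℝ) < (n : ℝ) ^ 2 - 1 := by nlinarith
  have h1 : ∑ k, ∑ l, ∑ m, Real.sign (x k i - x l i) * Real.sign (x k j - x m j) =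
      4 * ∑ k, (rank x k i - rankMean x i) * (rank x k j - rankMean x j) := by
    rw [Finset.mul_sum]
    refine Finset.sum_congr rfl fun k _ => ?_
    rw [rank_sub_rankMean hn0 hi, rank_sub_rankMean hn0 hj, ← Finset.sum_mul_sum]
    ring
  rw [spearmanRho, tripleMean, h1, sum_rank_sub_rankMean_sq hn0 hi, sum_rank_sub_rankMean_sq hn0 hj,
    Real.sqrt_mul_self (by positivity)]
  field_simp
  ring

lemma sum_filter_lt_add_sum_filter_lt {F : Fin n → Fin n → ℝ} (h0 : ∀ k, F k k = 0)
    (hF : ∀ k l, F k l = F l k) :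
    2 * ∑ k, ∑ l ∈ Finset.univ.filter (fun l => k < l), F k l = ∑ k, ∑ l, F k l := by
  have h1 : ∀ k, ∑ l, F k l = ∑ l ∈ Finset.univ.filter (fun l => k < l), F k l +
      ∑ l ∈ Finset.univ.filter (fun l => l < k), F k l := fun k => by
    simp_rw [Finset.sum_filter]
    rw [← Finset.sum_add_distrib]
    refine Finset.sum_congr rfl fun l _ => ?_
    rcases lt_trichotomy k l with h | h | h
    · simp [h, h.not_gt]
    · subst h; simp [h0]
    · simp [h, h.not_gt]
  have h2 : ∑ k, ∑ l ∈ Finset.univ.filter (fun l => l < k), F k l =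
      ∑ k, ∑ l ∈ Finset.univ.filter (fun l => k < l), F k l := by
    simp_rw [Finset.sum_filter]
    rw [Finset.sum_comm]
    simp_rw [hF]
  simp_rw [h1, Finset.sum_add_distrib, h2]
  ring

/-- The kernel is symmetric, vanishes for equal indices and ignores the third one, so only the
counting factor changes. Ties do no harm here. -/
lemma kendallTau_eq (hn : 2 ≤ n) :
    kendallTau x i j = (n : ℝ) / ((n : ℝ) - 1) * tripleMean
      (fun a b _ : Fin p → ℝ => Real.sign (a i - b i) * Real.sign (a j - b j)) x := by
  have hn' : (2 : ℝ) ≤ n := by exact_mod_cast hn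
  have hn1 : (n : ℝ) - 1 ≠ 0 := by linarith
  have h1 := sum_filter_lt_add_sum_filter_lt
    (F := fun k l => Real.sign ((x k i - x l i) * (x k j - x l j))) (by simp)
    (fun k l => by congr 1; ring)
  simp only [sign_mul_sign] at h1
  simp only [kendallTau, tripleMean, sign_mul_sign, Finset.sum_const, Finset.card_univ,
    Fintype.card_fin, nsmul_eq_mul, ← Finset.mul_sum]
  rw [← h1]
  field_simp

/-- The kernel whose triple average is, up to a factor close to one, the rank statistic. -/
noncomputable def rankKernel (T : RankStat) (i j : Fin p) (a b c : Fin p → ℝ) : ℝ :=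
  match T with
  | .spearman => Real.sign (a i - b i) * Real.sign (a j - c j)
  | .kendall => Real.sign (a i - b i) * Real.sign (a j - b j)

lemma abs_rankKernel_le (T : RankStat) (i j : Fin p) (a b c : Fin p → ℝ) :
    |rankKernel T i j a b c| ≤ 1 := by
  cases T <;> exact abs_sign_mul_sign_le_one _ _

lemma measurable_rankKernel (T : RankStat) (i j : Fin p) :
    Measurable fun z : (Fin p → ℝ) × (Fin p → ℝ) × (Fin p → ℝ) =>
      rankKernel T i j z.1 z.2.1 z.2.2 := by
  cases T <;>
    exact (measurable_sign.comp (by fun_prop)).mul (measurable_sign.comp (by fun_prop))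

/-- The Lipschitz link between the pilot matrix and the triple averages. The number `r` stands
for the population value. -/
lemma abs_pilot_sub_le (T : RankStat) (hn : 2 ≤ n)
    (hx : ∀ j, Function.Injective fun k => x k j) (hij : i ≠ j) {θ r : ℝ}
    (hθ : match T with
      | .spearman => 2 * Real.sin (Real.pi / 2 * θ) = r
      | .kendall => Real.sin (Real.pi / 2 * θ) = r) :
    |pilot T x i j - r| ≤ Real.pi * (|tripleMean (rankKernel T i j) x - θ| + 2 / n) := by
  have hn' : (2 : ℝ) ≤ n := by exact_mod_cast hn
  have hn0 : (0 : ℝ) < n := by linarith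
  set V := tripleMean (rankKernel T i j) x with hV
  have hV1 : |V| ≤ 1 := abs_tripleMean_le (abs_rankKernel_le T i j) x
  -- Here `c` is the finite-sample factor `n² / (n² - 1)` or `n / (n - 1)`. Sine is 1-Lipschitz and
  -- `|V| ≤ 1`, so the factor costs at most `2 / n`.
  have key : ∀ c : ℝ, 0 ≤ c → c - 1 ≤ 2 / n → 1 ≤ c →
      |Real.sin (Real.pi / 2 * (c * V)) - Real.sin (Real.pi / 2 * θ)| ≤
        Real.pi / 2 * (|V - θ| + 2 / n) := fun c _ hc1 hc2 => by
    refine (Real.abs_sin_sub_sin_le _ _).trans ?_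
    rw [← mul_sub, abs_mul, abs_of_pos (by positivity : 0 < Real.pi / 2)]
    refine mul_le_mul_of_nonneg_left ?_ (by positivity)
    have h1 : |(c - 1) * V| ≤ 2 / n := by
      rw [abs_mul, abs_of_nonneg (by linarith : 0 ≤ c - 1)]
      nlinarith [abs_nonneg V]
    calc |c * V - θ| = |(V - θ) + (c - 1) * V| := by ring_nf
      _ ≤ _ := (abs_add_le _ _).trans (by linarith)
  have hpos : 0 ≤ |V - θ| + 2 / n := by positivity
  have hπ := Real.pi_pos
  cases T with
  | spearman =>
    simp only at hθ
    have hn2 : (0 : ℝ) < (n : ℝ) ^ 2 - 1 := by nlinarith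
    have h1 : pilot .spearman x i j =
        2 * Real.sin (Real.pi / 2 * ((n : ℝ) ^ 2 / ((n : ℝ) ^ 2 - 1) * V)) := by
      simp only [pilot, Matrix.of_apply, if_neg hij]
      rw [spearmanRho_eq hn (hx i) (hx j)]
      have hV' : V = tripleMean
        (fun a b c : Fin p → ℝ => Real.sign (a i - b i) * Real.sign (a j - c j)) x := rfl
      rw [hV']
      congr 2
      ring
    have h2 := key ((n : ℝ) ^ 2 / ((n : ℝ) ^ 2 - 1)) (by positivity)
      (by rw [div_sub_one hn2.ne', div_le_div_iff₀ hn2 hn0]; nlinarith)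
      (by rw [le_div_iff₀ hn2]; linarith)
    rw [h1, ← hθ, ← mul_sub, abs_mul, abs_two]
    linarith
  | kendall =>
    simp only at hθ
    have hn1 : (0 : ℝ) < (n : ℝ) - 1 := by linarith
    have h1 : pilot .kendall x i j = Real.sin (Real.pi / 2 * ((n : ℝ) / ((n : ℝ) - 1) * V)) := by
      simp only [pilot, Matrix.of_apply, if_neg hij]
      rw [kendallTau_eq hn]
      rfl
    have h2 := key ((n : ℝ) / ((n : ℝ) - 1)) (by positivity)
      (by rw [div_sub_one hn1.ne', div_le_div_iff₀ hn1 hn0]; linarith)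
      (by rw [le_div_iff₀ hn1]; linarith)
    rw [h1, ← hθ]
    nlinarith

end Ranks

/-! ### Laws of differences of the latent Gaussian variables -/

section Latent

variable {n p : ℕ} {ν : Measure (Fin p → ℝ)} {S : Matrix (Fin p) (Fin p) ℝ} {f : Fin p → ℝ → ℝ}

/-- Test the quadratic form on `e_i + c e_j` with `c = 1` and `c = -1`. -/
lemma abs_apply_le_one_of_posSemidef (hS : S.PosSemidef) (hdiag : ∀ j, S j j = 1) (i j : Fin p) :
    |S i j| ≤ 1 := by
  have hsymm : S j i = S i j := by simpa using hS.1.apply i j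
  have key : ∀ c : ℝ, 0 ≤ 1 + 2 * c * S i j + c ^ 2 := fun c => by
    have h := hS.dotProduct_mulVec_nonneg (Pi.single i 1 + Pi.single j c)
    simp only [star_trivial, mulVec_add, add_dotProduct, single_dotProduct, Pi.add_apply,
      mulVec_single] at h
    simp [hdiag, hsymm] at h
    linarith
  rw [abs_le]
  constructor <;> linarith [key 1, key (-1)]

/-- Twice the form is `(1 - r)(a - b)² + (1 + r)(a + b)²`. Nonnegativity lets variances be added
through `Real.toNNReal`. -/
lemma quadratic_nonneg {r : ℝ} (hr : |r| ≤ 1) (a b : ℝ) : 0 ≤ a ^ 2 + b ^ 2 + 2 * (a * b * r) := by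
  obtain ⟨h1, h2⟩ := abs_le.1 hr
  nlinarith [mul_nonneg (sub_nonneg.2 h2) (sq_nonneg (a - b)),
    mul_nonneg (by linarith : 0 ≤ 1 + r) (sq_nonneg (a + b))]

/-- The law of a linear combination of two transformed coordinates. -/
lemma map_latent_combination (hS : S.PosSemidef) (hdiag : ∀ j, S j j = 1)
    (hf : ∀ j, Measurable (f j))
    (hν : ν.map (fun x => WithLp.toLp 2 (fun j => f j (x j))) = multivariateGaussian 0 S)
    (i j : Fin p) (a b : ℝ) :
    ν.map (fun x => a * f i (x i) + b * f j (x j)) =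
      gaussianReal 0 (a ^ 2 + b ^ 2 + 2 * (a * b * S i j)).toNNReal := by
  set L : StrongDual ℝ (EuclideanSpace ℝ (Fin p)) :=
    a • EuclideanSpace.proj i + b • EuclideanSpace.proj j with hL
  have hLx : ⇑L = (fun x => a * x i) + fun x => b * x j := by ext x; simp [hL]
  have hm : Measurable fun x : Fin p → ℝ => (WithLp.toLp 2 fun j => f j (x j)) :=
    (WithLp.measurable_toLp 2 _).comp
      (measurable_pi_iff.2 fun j => (hf j).comp (measurable_pi_apply j))
  have h1 : ν.map (fun x => a * f i (x i) + b * f j (x j)) = (multivariateGaussian 0 S).map L := by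
    rw [← hν, Measure.map_map L.continuous.measurable hm]
    congr 1
  have hmem : ∀ (c : ℝ) (k : Fin p),
      MemLp (fun x : EuclideanSpace ℝ (Fin p) => c * x k) 2 (multivariateGaussian 0 S) :=
    fun c k => (IsGaussian.memLp_dual (multivariateGaussian 0 S)
      (EuclideanSpace.proj k : StrongDual ℝ (EuclideanSpace ℝ (Fin p))) 2 (by simp)).const_mul c
  rw [h1, IsGaussian.map_eq_gaussianReal]
  congr 1
  · rw [L.integral_comp_id_comm IsGaussian.integrable_id, integral_id_multivariateGaussian, map_zero]
  · rw [hLx, variance_add (hmem a i) (hmem b j), covariance_const_mul_left,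
      covariance_const_mul_right, covariance_eval_multivariateGaussian hS,
      variance_const_mul, variance_const_mul, variance_eval_multivariateGaussian hS,
      variance_eval_multivariateGaussian hS, hdiag, hdiag]
    congr 1
    ring

variable [IsProbabilityMeasure ν]

/-- Linear combinations of transformed coordinates of different observations. -/
lemma iIndepFun_latent (hS : S.PosSemidef) (hdiag : ∀ j, S j j = 1) (hf : ∀ j, Measurable (f j))
    (hν : ν.map (fun x => WithLp.toLp 2 (fun j => f j (x j))) = multivariateGaussian 0 S)
    (i j : Fin p) (c d : Fin n → ℝ) {W : Fin n → (Fin n → Fin p → ℝ) → ℝ}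
    (hW : ∀ t, W t = fun x => c t * f i (x t i) + d t * f j (x t j)) :
    iIndepFun W (Measure.pi fun _ : Fin n => ν) ∧ (∀ t, Measurable (W t)) ∧
      ∀ t, (Measure.pi fun _ : Fin n => ν).map (W t) =
        gaussianReal 0 (c t ^ 2 + d t ^ 2 + 2 * (c t * d t * S i j)).toNNReal := by
  set g : Fin n → (Fin p → ℝ) → ℝ := fun t x => c t * f i (x i) + d t * f j (x j) with hg
  have hfx : ∀ j, Measurable fun x : Fin p → ℝ => f j (x j) := fun j =>
    (hf j).comp (measurable_pi_apply j)
  have hgm : ∀ t, Measurable (g t) := fun t => ((hfx i).const_mul _).add ((hfx j).const_mul _)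
  have hWg : W = fun t x => g t (x t) := funext hW
  subst hWg
  refine ⟨iIndepFun_pi fun t => (hgm t).aemeasurable,
    fun t => (hgm t).comp (measurable_pi_apply t), fun t => ?_⟩
  have h1 := Measure.map_map (μ := Measure.pi fun _ : Fin n => ν) (hgm t)
    (measurePreserving_eval (fun _ : Fin n => ν) t).measurable
  rw [(measurePreserving_eval (fun _ : Fin n => ν) t).map_eq] at h1
  exact h1.symm.trans (map_latent_combination hS hdiag hf hν i j (c t) (d t))

lemma map_latent_diff_two (hS : S.PosSemidef) (hdiag : ∀ j, S j j = 1)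
    (hf : ∀ j, Measurable (f j))
    (hν : ν.map (fun x => WithLp.toLp 2 (fun j => f j (x j))) = multivariateGaussian 0 S)
    (i j : Fin p) (a b : ℝ) {k l : Fin n} (hkl : k ≠ l) :
    (Measure.pi fun _ : Fin n => ν).map
        (fun x => a * (f i (x k i) - f i (x l i)) + b * (f j (x k j) - f j (x l j))) =
      gaussianReal 0 (2 * (a ^ 2 + b ^ 2 + 2 * (a * b * S i j))).toNNReal := by
  obtain ⟨hind, hWm, hlaw⟩ := iIndepFun_latent (n := n) hS hdiag hf hν i j
    (fun t => if t = k then a else -a) (fun t => if t = k then b else -b) fun t => rfl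
  have hq := quadratic_nonneg (abs_apply_le_one_of_posSemidef hS hdiag i j)
  have h := gaussianReal_add_gaussianReal_of_indepFun (hind.indepFun hkl) (hlaw k) (hlaw l)
  simp only [if_true, if_neg hkl.symm, neg_sq, neg_mul_neg, add_zero] at h
  rw [two_mul, Real.toNNReal_add (hq _ _) (hq _ _), ← h]
  congr 1
  ext x
  simp only [Pi.add_apply]
  ring

/-- The two differences share only observation `k`, so the covariance is `S i j` while each variance
is 2: the correlation is halved. This is the source of `r / 2` in Spearman's population value. -/
lemma map_latent_diff_three (hS : S.PosSemidef) (hdiag : ∀ j, S j j = 1)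
    (hf : ∀ j, Measurable (f j))
    (hν : ν.map (fun x => WithLp.toLp 2 (fun j => f j (x j))) = multivariateGaussian 0 S)
    (i j : Fin p) (a b : ℝ) {k l m : Fin n} (hkl : k ≠ l) (hkm : k ≠ m) (hlm : l ≠ m) :
    (Measure.pi fun _ : Fin n => ν).map
        (fun x => a * (f i (x k i) - f i (x l i)) + b * (f j (x k j) - f j (x m j))) =
      gaussianReal 0 (2 * (a ^ 2 + b ^ 2 + 2 * (a * b * (S i j / 2)))).toNNReal := by
  obtain ⟨hind, hWm, hlaw⟩ := iIndepFun_latent (n := n) hS hdiag hf hν i j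
    (fun t => if t = k then a else if t = l then -a else 0)
    (fun t => if t = k then b else if t = l then 0 else -b) fun t => rfl
  have hq := quadratic_nonneg (abs_apply_le_one_of_posSemidef hS hdiag i j)
  have h1 := gaussianReal_add_gaussianReal_of_indepFun (hind.indepFun hlm) (hlaw l) (hlaw m)
  have h := gaussianReal_add_gaussianReal_of_indepFun
    (hind.indepFun_add_left hWm l m k hkl.symm hkm.symm) h1 (hlaw k)
  simp only [if_true, if_neg hkl.symm, if_neg hkm.symm, if_neg hlm.symm, neg_sq, mul_zero,
    zero_mul, add_zero] at h
  have hv : 2 * (a ^ 2 + b ^ 2 + 2 * (a * b * (S i j / 2))) =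
      (a ^ 2 + 0 ^ 2) + (0 ^ 2 + b ^ 2) + (a ^ 2 + b ^ 2 + 2 * (a * b * S i j)) := by ring
  rw [hv, Real.toNNReal_add (by positivity) (hq _ _),
    Real.toNNReal_add (by positivity) (by positivity), ← h]
  congr 1
  ext x
  simp only [Pi.add_apply]
  ring

/-- The population value of the rank statistic, as a function of the latent correlation. -/
noncomputable def rankMoment (T : RankStat) (r : ℝ) : ℝ :=
  match T with
  | .spearman => 2 / Real.pi * Real.arcsin (r / 2)
  | .kendall => 2 / Real.pi * Real.arcsin r

lemma abs_two_div_pi_mul_arcsin_le (r : ℝ) : |2 / Real.pi * Real.arcsin r| ≤ 1 := by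
  have hπ := Real.pi_pos
  rw [abs_mul, abs_of_pos (by positivity : 0 < 2 / Real.pi), div_mul_eq_mul_div, div_le_one hπ]
  have : |Real.arcsin r| ≤ Real.pi / 2 :=
    abs_le.2 ⟨Real.neg_pi_div_two_le_arcsin r, Real.arcsin_le_pi_div_two r⟩
  linarith

lemma abs_rankMoment_le (T : RankStat) (r : ℝ) : |rankMoment T r| ≤ 1 := by
  cases T <;> exact abs_two_div_pi_mul_arcsin_le _

/-- The sine in the pilot matrix inverts the arcsine of Sheppard's formula, so the pilot targets the
latent correlation itself. -/
lemma sin_rankMoment (T : RankStat) {r : ℝ} (hr : |r| ≤ 1) :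
    match T with
      | .spearman => 2 * Real.sin (Real.pi / 2 * rankMoment T r) = r
      | .kendall => Real.sin (Real.pi / 2 * rankMoment T r) = r := by
  obtain ⟨h1, h2⟩ := abs_le.1 hr
  have hπ := Real.pi_ne_zero
  have h3 : ∀ y : ℝ, Real.pi / 2 * (2 / Real.pi * y) = y := fun y => by field_simp
  cases T with
  | spearman =>
    simp only [rankMoment]
    rw [h3, Real.sin_arcsin (by linarith) (by linarith)]
    ring
  | kendall =>
    simp only [rankMoment]
    rw [h3, Real.sin_arcsin h1 h2]

lemma ae_latent_ne (hS : S.PosSemidef) (hdiag : ∀ j, S j j = 1) (hf : ∀ j, Measurable (f j))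
    (hν : ν.map (fun x => WithLp.toLp 2 (fun j => f j (x j))) = multivariateGaussian 0 S)
    {k l : Fin n} (hkl : k ≠ l) (j : Fin p) :
    ∀ᵐ x ∂(Measure.pi fun _ : Fin n => ν), f j (x k j) ≠ f j (x l j) := by
  have hm : Measurable fun x : Fin n → Fin p → ℝ => f j (x k j) - f j (x l j) :=
    ((hf j).comp ((measurable_pi_apply j).comp (measurable_pi_apply k))).sub
      ((hf j).comp ((measurable_pi_apply j).comp (measurable_pi_apply l)))
  -- With coefficients 1 and 0 this is the law of a single difference, a centered Gaussian of
  -- variance 2, which has no atom at zero.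
  have h := map_latent_diff_two (n := n) hS hdiag hf hν j j 1 0 hkl
  simp only [one_mul, zero_mul, add_zero] at h
  have hna : NullSingletonClass (gaussianReal 0
      (2 * (1 ^ 2 + 0 ^ 2 + 2 * (0 : ℝ))).toNNReal) :=
    nullSingletonClass_gaussianReal (by simp)
  have h0 : ∀ᵐ y ∂((Measure.pi fun _ : Fin n => ν).map
      fun x => f j (x k j) - f j (x l j)), y ≠ 0 := by
    simp only [mul_zero] at h
    rw [h]
    simp only [mul_zero] at hna
    exact Measure.ae_ne _ 0
  filter_upwards [ae_of_ae_map hm.aemeasurable h0] with x hx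
  exact sub_ne_zero.1 hx

end Latent

/-! ### From the non-paranormal model to a uniformly accurate pilot -/

section Nonparanormal

variable {n p : ℕ} {ν : Measure (Fin p → ℝ)} {S : Matrix (Fin p) (Fin p) ℝ}

/-- Distinct images upgrade weak monotonicity to a strict comparison. The latent variables are
almost surely distinct, so strict monotonicity need not be assumed. -/
lemma sign_sub_eq_of_monotoneOn {g : ℝ → ℝ} {I : Set ℝ} (hg : MonotoneOn g I) {x y : ℝ}
    (hx : x ∈ I) (hy : y ∈ I) (hxy : g x ≠ g y) :
    Real.sign (x - y) = Real.sign (g x - g y) := by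
  rcases lt_trichotomy x y with h | h | h
  · rw [Real.sign_of_neg (sub_neg.2 h),
      Real.sign_of_neg (sub_neg.2 ((hg hx hy h.le).lt_of_ne hxy))]
  · exact absurd (congrArg g h) hxy
  · rw [Real.sign_of_pos (sub_pos.2 h),
      Real.sign_of_pos (sub_pos.2 ((hg hy hx h.le).lt_of_ne hxy.symm))]

/-- Almost surely there are no ties, and the mean of the kernel of either rank statistic is
given by the latent correlation. -/
lemma IsNonparanormal.ae_injective_and_integral [IsProbabilityMeasure ν]
    (h : IsNonparanormal ν S) :
    (∀ᵐ x ∂(Measure.pi fun _ : Fin n => ν), ∀ j, Function.Injective fun k => x k j) ∧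
    ∀ (T : RankStat) (i j : Fin p) (k l m : Fin n), k ≠ l → k ≠ m → l ≠ m →
      ∫ x, rankKernel T i j (x k) (x l) (x m) ∂(Measure.pi fun _ : Fin n => ν) =
        rankMoment T (S i j) := by
  obtain ⟨hSpd, hdiag, f, I, hf, hI, hmono, hmem, hν⟩ := h
  have hS := hSpd.posSemidef
  have hmem' : ∀ᵐ x ∂(Measure.pi fun _ : Fin n => ν), ∀ k j, x k j ∈ I j :=
    ae_all_iff.2 fun k =>
      (measurePreserving_eval (fun _ : Fin n => ν) k).quasiMeasurePreserving.ae hmem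
  have hne : ∀ᵐ x ∂(Measure.pi fun _ : Fin n => ν),
      ∀ k l j, k ≠ l → f j (x k j) ≠ f j (x l j) := by
    refine ae_all_iff.2 fun k => ae_all_iff.2 fun l => ae_all_iff.2 fun j => ?_
    by_cases hkl : k = l
    · simp [hkl]
    · filter_upwards [ae_latent_ne hS hdiag hf hν hkl j] with x hx _ using hx
  refine ⟨?_, fun T i j k l m hkl hkm hlm => ?_⟩
  · filter_upwards [hne] with x hx j k l hkl
    by_contra hne'
    exact hx k l j hne' (congrArg (f j) hkl)
  have hr := abs_apply_le_one_of_posSemidef hS hdiag i j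
  have hm : ∀ (j : Fin p) (k l : Fin n),
      Measurable fun x : Fin n → Fin p → ℝ => f j (x k j) - f j (x l j) := fun j k l =>
    ((hf j).comp ((measurable_pi_apply j).comp (measurable_pi_apply k))).sub
      ((hf j).comp ((measurable_pi_apply j).comp (measurable_pi_apply l)))
  have hsign : ∀ᵐ x ∂(Measure.pi fun _ : Fin n => ν), ∀ k l j, k ≠ l →
      Real.sign (x k j - x l j) = Real.sign (f j (x k j) - f j (x l j)) := by
    filter_upwards [hmem', hne] with x hx hx' k l j hkl
    exact sign_sub_eq_of_monotoneOn (hmono j) (hx k j) (hx l j) (hx' k l j hkl)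
  cases T with
  | spearman =>
    simp only [rankKernel, rankMoment]
    rw [← integral_sign_mul_sign_eq (hm i k l) (hm j k m) two_pos
      (by rw [abs_div, abs_two]; linarith)
      fun a b => map_latent_diff_three hS hdiag hf hν i j a b hkl hkm hlm]
    refine integral_congr_ae ?_
    filter_upwards [hsign] with x hx
    rw [hx k l i hkl, hx k m j hkm]
  | kendall =>
    simp only [rankKernel, rankMoment]
    rw [← integral_sign_mul_sign_eq (hm i k l) (hm j k l) two_pos hr
      fun a b => map_latent_diff_two hS hdiag hf hν i j a b hkl]
    refine integral_congr_ae ?_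
    filter_upwards [hsign] with x hx
    rw [hx k l i hkl, hx k l j hkl]

/-- Uniform concentration of the rank-based correlation matrix. -/
lemma IsNonparanormal.measure_pilot_le [IsProbabilityMeasure ν] (h : IsNonparanormal ν S)
    (T : RankStat) (hn : 2 ≤ n) (hp : 2 ≤ p) :
    (Measure.pi fun _ : Fin n => ν)
      {x | ¬ ∀ i j, |pilot T x i j - S i j| ≤ 100 * √(Real.log p / n)} ≤
        ENNReal.ofReal (2 / p) := by
  set μ := Measure.pi fun _ : Fin n => ν with hμ
  set δ := √(Real.log p / n) with hδ
  have hn' : (2 : ℝ) ≤ n := by exact_mod_cast hn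
  have hn0 : (0 : ℝ) < n := by linarith
  have hp' : (2 : ℝ) ≤ p := by exact_mod_cast hp
  have hp0 : (0 : ℝ) < p := by linarith
  have hlog : 1 / 2 ≤ Real.log p := by
    have := Real.log_two_gt_d9
    linarith [Real.log_le_log two_pos hp']
  have hδ2 : δ ^ 2 = Real.log p / n := Real.sq_sqrt (by positivity)
  have hδn : 1 / (n : ℝ) ≤ 2 * δ := by
    have h1 : 1 / (2 * (n : ℝ)) ≤ δ := by
      refine Real.le_sqrt_of_sq_le ?_
      rw [div_pow, div_le_div_iff₀ (by positivity) hn0]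
      nlinarith
    calc 1 / (n : ℝ) = 2 * (1 / (2 * n)) := by field_simp
      _ ≤ _ := by linarith
  have hδ0 : 0 ≤ δ := Real.sqrt_nonneg _
  obtain ⟨hinj, hmom⟩ := h.ae_injective_and_integral (n := n)
  obtain ⟨hSpd, hdiag, -⟩ := h
  have hr := abs_apply_le_one_of_posSemidef hSpd.posSemidef hdiag
  -- The factor 15 gives the exponent `-(225 / 72) log p`, below `-3 log p`, so that `p²` events of
  -- probability at most `2 / p³` sum to `2 / p`.
  set A : Fin p → Fin p → Set (Fin n → Fin p → ℝ) := fun i j =>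
    {x | 15 * δ + 6 / n ≤ |tripleMean (rankKernel T i j) x - rankMoment T (S i j)|} with hA
  have hAm : ∀ i j, μ (A i j) ≤ ENNReal.ofReal (2 / (p : ℝ) ^ 3) := fun i j => by
    have h1 := measureReal_tripleMean_le ν (n := n) (by omega) (abs_rankKernel_le T i j)
      (measurable_rankKernel T i j) (abs_rankMoment_le T (S i j)) (hmom T i j)
      (u := 15 * δ) (by positivity)
    have h2 : Real.exp (-(n * (15 * δ) ^ 2) / 72) ≤ 1 / (p : ℝ) ^ 3 := by
      rw [mul_pow, hδ2, one_div, ← Real.exp_log (by positivity : 0 < ((p : ℝ) ^ 3)⁻¹),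
        Real.exp_le_exp, Real.log_inv, Real.log_pow]
      push_cast
      have h3 : (n : ℝ) * (15 ^ 2 * (Real.log p / n)) = 225 * Real.log p := by field_simp; norm_num
      rw [h3]
      linarith
    rw [← ofReal_measureReal]
    refine ENNReal.ofReal_le_ofReal (h1.trans ?_)
    calc 2 * Real.exp (-(n * (15 * δ) ^ 2) / 72) ≤ 2 * (1 / (p : ℝ) ^ 3) := by gcongr
      _ = _ := by ring
  have hsub : {x | ¬ ∀ i j, |pilot T x i j - S i j| ≤ 100 * δ} ⊆
      {x | ¬ ∀ j, Function.Injective fun k => x k j} ∪ ⋃ i, ⋃ j, A i j := by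
    intro x hx
    by_contra hx'
    simp only [Set.mem_union, Set.mem_iUnion, Set.mem_ofPred_eq, not_or, not_not, not_exists,
      hA, not_le] at hx'
    obtain ⟨hx1, hx2⟩ := hx'
    refine hx fun i j => ?_
    by_cases hij : i = j
    · subst hij
      simp only [pilot, Matrix.of_apply, if_true, hdiag, sub_self, abs_zero]
      positivity
    refine (abs_pilot_sub_le T hn hx1 hij (sin_rankMoment T (hr i j))).trans ?_
    have h1 := hx2 i j
    -- `15 δ + 8 / n ≤ 31 δ` because `1 / n ≤ 2 δ`; then `3.15 * 31 < 100`.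
    have h2 : |tripleMean (rankKernel T i j) x - rankMoment T (S i j)| + 2 / n ≤ 31 * δ := by
      have h3 : (6 : ℝ) / n = 6 * (1 / n) := by ring
      have h4 : (2 : ℝ) / n = 2 * (1 / n) := by ring
      linarith
    calc Real.pi * (|tripleMean (rankKernel T i j) x - rankMoment T (S i j)| + 2 / n)
        ≤ 3.15 * (31 * δ) := by
          gcongr
          exact Real.pi_lt_d2.le
      _ ≤ _ := by linarith
  calc μ {x | ¬ ∀ i j, |pilot T x i j - S i j| ≤ 100 * δ}
      ≤ μ {x | ¬ ∀ j, Function.Injective fun k => x k j} + μ (⋃ i, ⋃ j, A i j) :=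
        (measure_mono hsub).trans (measure_union_le _ _)
    _ = μ (⋃ i, ⋃ j, A i j) := by rw [ae_iff.1 hinj, zero_add]
    _ ≤ ∑ i, ∑ j, μ (A i j) := by
        refine (measure_iUnion_fintype_le _ _).trans (Finset.sum_le_sum fun i _ => ?_)
        exact measure_iUnion_fintype_le _ _
    _ ≤ ∑ _i : Fin p, ∑ _j : Fin p, ENNReal.ofReal (2 / (p : ℝ) ^ 3) :=
        Finset.sum_le_sum fun i _ => Finset.sum_le_sum fun j _ => hAm i j
    _ = ENNReal.ofReal (2 / p) := by
        simp only [Finset.sum_const, Finset.card_univ, Fintype.card_fin, nsmul_eq_mul]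
        rw [← ENNReal.ofReal_natCast, ← ENNReal.ofReal_mul hp0.le, ← ENNReal.ofReal_mul hp0.le]
        congr 1
        field_simp

/-- The same for a sample on any probability space. -/
lemma IsNonparanormalSample.measure_pilot_le {Ω : Type*} [MeasurableSpace Ω] {P : Measure Ω}
    [IsProbabilityMeasure P] {X : Fin n → Ω → Fin p → ℝ} (h : IsNonparanormalSample P X S)
    (T : RankStat) (hn : 2 ≤ n) (hp : 2 ≤ p) :
    P {ω | ¬ ∀ i j, |pilot T (fun l => X l ω) i j - S i j| ≤ 100 * √(Real.log p / n)} ≤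
      ENNReal.ofReal (2 / p) := by
  obtain ⟨hind, ν, hν, hlaw⟩ := h
  have : IsProbabilityMeasure ν := (hlaw ⟨0, by omega⟩).isProbabilityMeasure_iff.1 inferInstance
  have hX : ∀ k, AEMeasurable (X k) P := fun k => (hlaw k).aemeasurable
  have hmap : P.map (fun ω k => X k ω) = Measure.pi fun _ : Fin n => ν := by
    rw [(iIndepFun_iff_map_fun_eq_pi_map hX).1 hind]
    congr 1
    exact funext fun k => (hlaw k).map_eq
  refine le_trans ?_ (hν.measure_pilot_le T hn hp)
  rw [← hmap]
  -- This inequality holds for arbitrary sets, so the event need not be shown measurable.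
  exact Measure.le_map_apply (aemeasurable_pi_lambda _ hX)
    {x | ¬ ∀ i j, |pilot T x i j - S i j| ≤ 100 * √(Real.log p / n)}

end Nonparanormal

/-! ### Choice of the level and the final rates -/

section Rate

variable {n p : ℕ} {q s M ε C₀ : ℝ} {S : Matrix (Fin p) (Fin p) ℝ}

lemma pos_of_mem_sparseClass {W : Matrix (Fin p) (Fin p) ℝ} (hp : 0 < p)
    (hW : W ∈ sparseClass p q s M) : 0 ≤ s ∧ 0 < M := by
  obtain ⟨hpd, hs, hM⟩ := hW
  set j : Fin p := ⟨0, hp⟩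
  refine ⟨(Finset.sum_nonneg fun i _ => absPow_nonneg q (W i j)).trans (hs j), ?_⟩
  have h1 : 0 < W j j := hpd.diag_pos
  calc 0 < |W j j| := abs_pos.2 h1.ne'
    _ ≤ ∑ i, |W i j| := Finset.single_le_sum (f := fun i => |W i j|) (fun _ _ => abs_nonneg _)
        (Finset.mem_univ j)
    _ ≤ M := (sum_le_colNorm W j).trans hM

lemma posSemidef_of_posSemidef_sub (hε : 0 ≤ ε)
    (h : (S - ε • (1 : Matrix (Fin p) (Fin p) ℝ)).PosSemidef) : S.PosSemidef := by
  have := h.add (Matrix.PosSemidef.one.smul hε)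
  rwa [sub_add_cancel] at this

/-- The rates of convergence of the estimator on the event that the pilot is accurate. -/
lemma IsRankSCIO.error_bounds {T : RankStat} {x : Fin n → Fin p → ℝ}
    {W : Matrix (Fin p) (Fin p) ℝ} (hn : 0 < n) (hp : 2 ≤ p) (hC₀ : 400 ≤ C₀) (hq : 0 ≤ q)
    (hq1 : q < 1) (hSpd : S.PosDef) (hΩ : S⁻¹ ∈ sparseClass p q s M) (hε : 0 < ε)
    (hSε : (S - ε • (1 : Matrix (Fin p) (Fin p) ℝ)).PosSemidef)
    (hsmall : s * M ^ (1 - 2 * q) ≤ 1 / 1600 * ((n : ℝ) / Real.log p) ^ (1 / 2 - q / 2))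
    (hpilot : ∀ i j, |pilot T x i j - S i j| ≤ 100 * √(Real.log p / n))
    (hW : IsRankSCIO T ε (C₀ * M * √(Real.log p / n)) x W) :
    maxNorm (W - S⁻¹) ≤ (3 * C₀ + 1) * M ^ 2 * √(Real.log p / n) ∧
      colNorm (W - S⁻¹) ≤ (12 * C₀ + 10) * s * M ^ (2 - 2 * q) *
        (Real.log p / n) ^ ((1 / 2 : ℝ) * (1 - q)) := by
  obtain ⟨hs, hM⟩ := pos_of_mem_sparseClass (by omega) hΩ
  obtain ⟨Ŝ, hproj, hscio⟩ := hW
  have hn' : (0 : ℝ) < n := by exact_mod_cast hn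
  have hlog : 0 < Real.log p := Real.log_pos (by exact_mod_cast hp)
  have hR : 0 < Real.log p / n := by positivity
  set δ := √(Real.log p / n) with hδ
  have hδ0 : 0 < δ := Real.sqrt_pos.2 hR
  have hMpow : ∀ y : ℝ, (M ^ 2) ^ y = M ^ (2 * y) := fun y => by
    rw [← Real.rpow_natCast, ← Real.rpow_mul hM.le]
    norm_num
  have hδpow : ∀ y : ℝ, δ ^ y = (Real.log p / n) ^ (1 / 2 * y) := fun y => by
    rw [hδ, Real.sqrt_eq_rpow, ← Real.rpow_mul hR.le]
  have ht : 0 < M ^ 2 * δ := by positivity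
  have hinv : ((n : ℝ) / Real.log p) ^ (1 / 2 - q / 2) = (δ ^ (1 - q))⁻¹ := by
    rw [hδpow, ← Real.inv_rpow hR.le, inv_div]
    congr 1
    ring
  -- This is the sparsity assumption after dividing by `M ^ (2 * q) * δ ^ q`; the constant `1 /
  -- 1600` is `1 / (8 * 200)`.
  have hsm : 8 * (M * (200 * δ) * s) ≤ (M ^ 2 * δ) ^ q := by
    rw [hinv] at hsmall
    have h1 : s * M ^ (1 - 2 * q) * δ ^ (1 - q) ≤ 1 / 1600 := by
      have h2 : 0 < δ ^ (1 - q) := Real.rpow_pos_of_pos hδ0 _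
      have := mul_le_mul_of_nonneg_right hsmall h2.le
      rwa [mul_assoc (1 / 1600 : ℝ), inv_mul_cancel₀ h2.ne', mul_one] at this
    have hMq : M ^ (1 - 2 * q) * M ^ (2 * q) = M := by
      rw [← Real.rpow_add hM, sub_add_cancel, Real.rpow_one]
    have hδq : δ ^ (1 - q) * δ ^ q = δ := by
      rw [← Real.rpow_add hδ0, sub_add_cancel, Real.rpow_one]
    rw [Real.mul_rpow (by positivity) hδ0.le, hMpow]
    calc 8 * (M * (200 * δ) * s)
        = 1600 * (s * M ^ (1 - 2 * q) * δ ^ (1 - q)) * (M ^ (2 * q) * δ ^ q) := by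
          calc 8 * (M * (200 * δ) * s) = 1600 * (s * M * δ) := by ring
            _ = 1600 * (s * (M ^ (1 - 2 * q) * M ^ (2 * q)) * (δ ^ (1 - q) * δ ^ q)) := by
              rw [hMq, hδq]
            _ = _ := by ring
      _ ≤ 1600 * (1 / 1600) * (M ^ (2 * q) * δ ^ q) := by gcongr
      _ = _ := by ring
  have hŜS : ∀ i j, |Ŝ i j - S i j| ≤ 200 * δ := fun i j => by
    have := hproj.abs_sub_le hSε (by positivity) hpilot i j
    linarith
  -- The level `t` is chosen so that `M * lam = C₀ * t`. The requirement `d * M ≤ lam / 2` reads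
  -- `200 ≤ C₀ / 2`, whence the threshold 400.
  have h := hscio.error_bounds (d := 200 * δ) (t := M ^ 2 * δ) (C := C₀) hSpd hΩ hq hq1
    (posSemidef_of_posSemidef_sub hε.le hproj.1) (isSymm_of_posSemidef_sub hproj.1)
    (by positivity) hŜS (by positivity)
    (by nlinarith [mul_pos hM hδ0]) ht (by linarith) (by nlinarith) hsm hs
  refine ⟨h.1.trans_eq (by ring), h.2.trans_eq ?_⟩
  rw [Real.mul_rpow (by positivity) hδ0.le, hMpow, hδpow]
  ring_nf

end Rate

end SCIO

theorem corollary3 :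
    -- `C₀` is large enough: the threshold is an absolute constant
    ∃ c₀ : ℝ, 0 < c₀ ∧ ∀ C₀ : ℝ, c₀ ≤ C₀ → ∀ q : ℝ, 0 ≤ q → q < 1 →
    -- the constants of the two bounds and of the `O(p⁻¹)` depend on `C₀` and `q` only
    ∃ C₁ C₂ K : ℝ, 0 < C₁ ∧ 0 < C₂ ∧ 0 < K ∧
    -- a sequence of problems with sample sizes `n k → ∞` and dimensions `p k`
    ∀ (n p : ℕ → ℕ), Tendsto n atTop atTop → (∀ k, 2 ≤ p k) →
    ∀ (s M ε : ℕ → ℝ) (S : (k : ℕ) → Matrix (Fin (p k)) (Fin (p k)) ℝ),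
    -- (A1), for the precision matrix `(S k)⁻¹`
    (∀ k, (S k)⁻¹ ∈ SCIO.sparseClass (p k) q (s k) (M k)) →
    (fun k => s k * M k ^ (1 - 2 * q)) =o[atTop]
      (fun k => ((n k : ℝ) / Real.log (p k)) ^ (1 / 2 - q / 2)) →
    -- the projection level is small enough: the set projected on contains the true matrix
    (∀ k, 0 < ε k ∧ (S k - ε k • (1 : Matrix (Fin (p k)) (Fin (p k)) ℝ)).PosSemidef) →
    -- independent non-paranormal data
    ∀ (Ω : ℕ → Type*) [∀ k, MeasurableSpace (Ω k)] (P : (k : ℕ) → Measure (Ω k))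
      [∀ k, IsProbabilityMeasure (P k)] (X : (k : ℕ) → Fin (n k) → Ω k → Fin (p k) → ℝ),
    (∀ k, SCIO.IsNonparanormalSample (P k) (X k) (S k)) →
    ∀ T : SCIO.RankStat, ∀ᶠ k in atTop,
      -- outside an event of (outer) probability at most `K / p`, an estimator exists and
      -- every one of them obeys both bounds
      P k {ω | ¬ ((∃ W, SCIO.IsRankSCIO T (ε k) (C₀ * M k * √(Real.log (p k) / n k))
            (fun l => X k l ω) W) ∧
          ∀ W, SCIO.IsRankSCIO T (ε k) (C₀ * M k * √(Real.log (p k) / n k))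
            (fun l => X k l ω) W →
            SCIO.maxNorm (W - (S k)⁻¹) ≤ C₁ * M k ^ 2 * √(Real.log (p k) / n k) ∧
            SCIO.colNorm (W - (S k)⁻¹) ≤
              C₂ * s k * M k ^ (2 - 2 * q) *
                (Real.log (p k) / n k) ^ ((1 / 2 : ℝ) * (1 - q)))}
        ≤ ENNReal.ofReal (K / p k) := by

  refine ⟨400, by norm_num, fun C₀ hC₀ q hq hq1 => ⟨3 * C₀ + 1, 12 * C₀ + 10, 2, by linarith,
    by linarith, two_pos, ?_⟩⟩
  intro n p hn hp s M ε S hΩ hrate hε Ω _ P _ X hX T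
  -- The little-o assumption enters only through the single constant `1 / 1600`.
  filter_upwards [hn.eventually_ge_atTop 2,
    hrate.bound (by norm_num : (0 : ℝ) < 1 / 1600)] with k hnk hk
  obtain ⟨-, hM⟩ := SCIO.pos_of_mem_sparseClass (by have := hp k; omega) (hΩ k)
  have hSpd : (S k).PosDef := by
    obtain ⟨-, ν, hν, -⟩ := hX k
    exact hν.1
  have hlog : 0 < Real.log (p k) := Real.log_pos (by exact_mod_cast hp k)
  have hsmall : s k * M k ^ (1 - 2 * q) ≤
      1 / 1600 * ((n k : ℝ) / Real.log (p k)) ^ (1 / 2 - q / 2) := by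
    refine (le_abs_self _).trans (hk.trans_eq ?_)
    rw [Real.norm_eq_abs, abs_of_nonneg (by positivity)]
  refine le_trans (measure_mono fun ω hω => ?_)
    ((hX k).measure_pilot_le T hnk (hp k))
  intro hpilot
  exact hω ⟨SCIO.exists_isRankSCIO T (hε k).1 (hε k).2 (by positivity) _, fun W hW =>
    hW.error_bounds (by omega) (hp k) hC₀ hq hq1 hSpd (hΩ k) (hε k).1 (hε k).2 hsmall hpilot⟩
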